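/- Let $0<\beta\le 1$ and let $E_\beta(z)=\sum_{n\ge 0} z^n/\Gamma(\beta n+1)$ be the Mittag-Leffler function. Let $\mathcal N\subset\mathcal H\subset\mathcal N'$ be a nuclear triple: $\mathcal H$ is a real separable Hilbert space, $\mathcal N$ is densely embedded in $\mathcal H$ and is the projective limit of a chain $\mathcal H=\mathcal H_0\supset\mathcal H_1\supset\mathcal H_2\supset\cdots$ of real separable Hilbert spaces with Hilbert--Schmidt inclusions $\mathcal H_{p+1}\subset\mathcal H_p$ and norms $|\cdot|_p\le|\cdot|_{p+1}$; $\mathcal N'$ is its dual, with the $\sigma$-algebra generated by the cylinder sets. The Mittag-Leffler measure $\mu_\beta$ is the probability measure on $\mathcal N'$ with $\int_{\mathcal N'} e^{i\langle\omega,\varphi\rangle}\,d\mu_\beta(\omega)=E_\beta\bigl(-\tfrac12\langle\varphi,\varphi\rangle\bigr)$ for all $\varphi\in\mathcal N$. For $\eta\in\mathcal H$, $\langle\cdot,\eta\rangle$ denotes the limit in $L^2(\mu_\beta)$ of $\langle\cdot,\varphi\rangle$ as $\varphi\in\mathcal N$ tends to $\eta$ in $\mathcal H$. (1) Let $n\ge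 1$ and let $\varphi_1,\dots,\varphi_n$ be orthonormal in $\mathcal H$. The random variables $\langle\cdot,\varphi_1\rangle,\dots,\langle\cdot,\varphi_n\rangle$ on $(\mathcal N',\mu_\beta)$ are independent if and only if $n=1$ or $\beta=1$. (2) Let $d\ge 2$ and $0<\alpha<2$, and let $\mu_\beta$ be the Mittag-Leffler measure on $\mathcal S_d'(\mathbb R)$ for the triple $\mathcal S_d(\mathbb R)\subset L^2(\mathbb R,dx;\mathbb R^d)\subset\mathcal S_d'(\mathbb R)$, where $\mathcal S_d(\mathbb R)$ is the space of $\mathbb R^d$-valued Schwartz functions. Let $B=(B_1,\dots,B_d)$ with $B_k(t)=\langle\cdot,(M^{\alpha/2}_-\mathbf 1_{[0,t)})\,\mathbf e_k\rangle$ for $t\ge0$, where $\mathbf e_k$ is the $k$-th unit vector of $\mathbb R^d$ and, with $K=\sqrt{\alpha\sin(\alpha\pi/2)\Gamma(\alpha)}$, the operator $M^{\alpha/2}_-$ is $K$ times the Marchaud fractional derivative $(D^r_-f)(x)=\lim_{\varepsilon\to0+}\frac{r}{\Gamma(1-r)}\int_\varepsilon^\infty\frac{f(x)-f(x+s)}{s^{1+r}}\,ds$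 with $r=\frac{1-\alpha}{2}$ if $\alpha<1$, the identity if $\alpha=1$, and $K$ times the Riemann--Liouville integral $(I^r_-f)(x)=\frac1{\Gamma(r)}\int_0^\infty f(x+s)s^{r-1}\,ds$ with $r=\frac{\alpha-1}{2}$ if $\alpha>1$. The following are equivalent: (a) for each $t\ge 0$ the components $B_1(t),\dots,B_d(t)$ are independent; (b) the component processes $B_1,\dots,B_d$ are independent; (c) $B$ is a $d$-dimensional fractional Brownian motion with Hurst parameter $\alpha/2$, i.e. a centred Gaussian process with $\operatorname{Cov}(B_i(s),B_j(t))=\delta_{ij}\,\tfrac12\bigl(s^{\alpha}+t^{\alpha}-|s-t|^{\alpha}\bigr)$; (d) $\beta=1$. -/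

import Mathlib

open MeasureTheory ProbabilityTheory Filter Topology Set
open scoped NNReal ENNReal

noncomputable section

namespace MittagLeffler

universe u v

/-! ### Nuclear triples -/

/-- A bounded operator between Hilbert spaces is Hilbert-Schmidt if `∑ ‖T e_i‖²` is finite for
some (equivalently, for every) Hilbert basis `(e_i)` of its domain. -/
def IsHilbertSchmidt {E F : Type v} [NormedAddCommGroup E] [InnerProductSpace ℝ E]
    [NormedAddCommGroup F] [InnerProductSpace ℝ F] (T : E →L[ℝ] F) : Prop :=
  ∃ (κ : Type v) (e : HilbertBasis κ ℝ E), Summable fun i => ‖T (e i)‖ ^ 2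

/-- A nuclear triple `N ⊂ H ⊂ N'`: the space `N` is densely embedded in the Hilbert space `H`,
and it is the projective limit of a decreasing chain `H = H_0 ⊃ H_1 ⊃ H_2 ⊃ ⋯` of separable
Hilbert spaces whose inclusions are Hilbert-Schmidt and satisfy `|·|_p ≤ |·|_{p+1}`.
Inclusions are represented by injective maps. -/
structure NuclearTriple (N : Type u) [AddCommGroup N] [Module ℝ N] [TopologicalSpace N]
    (H : Type v) [NormedAddCommGroup H] [InnerProductSpace ℝ H] where
  /-- the inclusion `N ⊂ H` -/
  incl : N →L[ℝ] H
  incl_injective : Function.Injective incl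
  incl_denseRange : DenseRange incl
  /-- the Hilbert spaces `H_p` -/
  space : ℕ → Type v
  [normedAddCommGroup : ∀ p, NormedAddCommGroup (space p)]
  [innerProductSpace : ∀ p, InnerProductSpace ℝ (space p)]
  [completeSpace : ∀ p, CompleteSpace (space p)]
  [separableSpace : ∀ p, TopologicalSpace.SeparableSpace (space p)]
  /-- `H_0 = H` -/
  zero : space 0 ≃ₗᵢ[ℝ] H
  /-- the inclusion `H_{p+1} ⊂ H_p` -/
  step : ∀ p, space (p + 1) →L[ℝ] space p
  step_injective : ∀ p, Function.Injective (step p)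
  step_hilbertSchmidt : ∀ p, IsHilbertSchmidt (step p)
  norm_step_le : ∀ p x, ‖step p x‖ ≤ ‖x‖
  /-- the inclusion `N ⊂ H_p` -/
  proj : ∀ p, N →ₗ[ℝ] space p
  zero_proj : ∀ φ, zero (proj 0 φ) = incl φ
  step_proj : ∀ p φ, step p (proj (p + 1) φ) = proj p φ
  /-- as a set, `N` is the intersection of the `H_p` -/
  exists_of_compatible : ∀ x : ∀ p, space p, (∀ p, step p (x (p + 1)) = x p) →
    ∃ φ : N, ∀ p, proj p φ = x p
  /-- `N` carries the coarsest topology that makes all the inclusions `N ⊂ H_p` continuous -/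
  topology_eq : (inferInstance : TopologicalSpace N) =
    ⨅ p, TopologicalSpace.induced (proj p) inferInstance

/-! ### The Mittag-Leffler measure -/

/-- The dual space `N'` (continuous linear functionals on `N`) carries the `σ`-algebra
generated by the cylinder sets `{ω | (⟨ω, φ_1⟩, …, ⟨ω, φ_n⟩) ∈ A}`, `A` Borel in `ℝⁿ`. -/
instance cylinderMeasurableSpace (N : Type u) [AddCommGroup N] [Module ℝ N]
    [TopologicalSpace N] : MeasurableSpace (WeakDual ℝ N) :=
  MeasurableSpace.generateFrom
    {S | ∃ (n : ℕ) (φ : Fin n → N) (A : Set (Fin n → ℝ)), MeasurableSet A ∧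
      S = {ω : WeakDual ℝ N | (fun i => ω (φ i)) ∈ A}}

/-- The Mittag-Leffler function `E_β(z) = ∑ zⁿ / Γ(β n + 1)`. -/
def mittagLefflerE (β : ℝ) (z : ℂ) : ℂ :=
  ∑' n : ℕ, z ^ n / Complex.Gamma ((β : ℂ) * n + 1)

section

variable {N : Type u} [AddCommGroup N] [Module ℝ N] [TopologicalSpace N]
  {H : Type v} [NormedAddCommGroup H] [InnerProductSpace ℝ H]

/-- `μ` is the Mittag-Leffler measure `μ_β` on `N'`, for `N` included in `H` by `incl`: the
probability measure whose characteristic function is `φ ↦ E_β(-½ ⟨φ, φ⟩)`. -/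
structure IsMittagLefflerMeasure (β : ℝ) (incl : N →L[ℝ] H) (μ : Measure (WeakDual ℝ N)) :
    Prop where
  isProbabilityMeasure : IsProbabilityMeasure μ
  charFun_eq : ∀ φ : N, ∫ ω, Complex.exp (Complex.I * (ω φ : ℂ)) ∂μ =
    mittagLefflerE β (((-(1 / 2) * inner ℝ (incl φ) (incl φ) : ℝ)) : ℂ)

/-- The class of `f` in `L²(μ; E)`. It is used for square-integrable `f` only. -/
def toL2 {Ω : Type*} [MeasurableSpace Ω] {E : Type*} [NormedAddCommGroup E] (μ : Measure Ω)
    (f : Ω → E) : Lp E 2 μ :=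
  open Classical in if h : MemLp f 2 μ then h.toLp f else 0

/-- The random variable `⟨·, η⟩` for `η ∈ H`: the limit in `L²(μ)` of `⟨·, φ⟩` as `φ ∈ N`
converges to `η` in `H`. -/
def pairing (incl : N →L[ℝ] H) (μ : Measure (WeakDual ℝ N)) (η : H) : Lp ℝ 2 μ :=
  limUnder (comap incl (𝓝 η)) fun φ : N => toL2 μ fun ω : WeakDual ℝ N => ω φ

end

/-! ### Generalized grey Brownian motion -/

/-- The Riemann-Liouville fractional integral
`(I^r_- f)(x) = Γ(r)⁻¹ ∫_0^∞ f(x + s) s^{r-1} ds`. -/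
def riemannLiouvilleMinus (r : ℝ) (f : ℝ → ℝ) (x : ℝ) : ℝ :=
  1 / Real.Gamma r * ∫ s in Ioi (0 : ℝ), f (x + s) * s ^ (r - 1)

/-- The Marchaud fractional derivative
`(D^r_- f)(x) = lim_{ε → 0+} r Γ(1-r)⁻¹ ∫_ε^∞ (f(x) - f(x + s)) s^{-1-r} ds`. -/
def marchaudMinus (r : ℝ) (f : ℝ → ℝ) (x : ℝ) : ℝ :=
  limUnder (𝓝[>] (0 : ℝ)) fun ε : ℝ =>
    r / Real.Gamma (1 - r) * ∫ s in Ioi ε, (f x - f (x + s)) / s ^ (1 + r)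

/-- The operator `M^{α/2}_-`, `0 < α < 2`, with `K_{α/2} = √(α sin(α π / 2) Γ(α))`. -/
def fracOpMinus (α : ℝ) (f : ℝ → ℝ) (x : ℝ) : ℝ :=
  if α < 1 then
    √(α * Real.sin (α * Real.pi / 2) * Real.Gamma α) * marchaudMinus ((1 - α) / 2) f x
  else if α = 1 then f x
  else √(α * Real.sin (α * Real.pi / 2) * Real.Gamma α) *
    riemannLiouvilleMinus ((α - 1) / 2) f x

/-- The space `S_d(ℝ)` of `ℝ^d`-valued Schwartz functions on `ℝ`. -/
abbrev SchwartzD (d : ℕ) : Type := SchwartzMap ℝ (EuclideanSpace ℝ (Fin d))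

/-- The Hilbert space `L²_d(ℝ) = L²(ℝ, dx; ℝ^d)`. -/
abbrev L2D (d : ℕ) : Type := Lp (EuclideanSpace ℝ (Fin d)) 2 (volume : Measure ℝ)

/-- The inclusion `S_d(ℝ) ⊂ L²_d(ℝ)`. -/
def schwartzIncl (d : ℕ) : SchwartzD d →L[ℝ] L2D d :=
  SchwartzMap.toLpCLM ℝ (EuclideanSpace ℝ (Fin d)) 2 volume

/-- The element `(M^{α/2}_- 1_{[0,t)}) e_k` of `L²_d(ℝ)`. -/
def ggbmKernel (d : ℕ) (α : ℝ) (k : Fin d) (t : ℝ≥0) : L2D d :=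
  toL2 volume fun x : ℝ =>
    EuclideanSpace.single k (fracOpMinus α (indicator (Ico (0 : ℝ) t) fun _ => 1) x)

/-- The `k`-th component `⟨·, (M^{α/2}_- 1_{[0,t)}) e_k⟩` at time `t` of the vector-valued
generalized grey Brownian motion built on the measure `μ` on `S_d'(ℝ)`. -/
def ggbm (d : ℕ) (α : ℝ) (μ : Measure (WeakDual ℝ (SchwartzD d))) (k : Fin d) (t : ℝ≥0) :
    WeakDual ℝ (SchwartzD d) → ℝ :=
  pairing (schwartzIncl d) μ (ggbmKernel d α k t)

/-- The process `B = (B_1, …, B_d)` is a `d`-dimensional fractional Brownian motion with Hurst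
parameter `h` (in the sense of finite-dimensional distributions): a centred Gaussian process
with `Cov(B_i(s), B_j(t)) = δ_{ij} ½ (s^{2h} + t^{2h} - |s - t|^{2h})`. -/
structure IsFractionalBrownianMotion {Ω : Type*} [MeasurableSpace Ω] {d : ℕ} (h : ℝ)
    (B : Fin d → ℝ≥0 → Ω → ℝ) (P : Measure Ω) : Prop where
  isGaussianProcess : IsGaussianProcess (fun (p : Fin d × ℝ≥0) => B p.1 p.2) P
  mean_eq_zero : ∀ i t, ∫ ω, B i t ω ∂P = 0
  cov_eq : ∀ i j s t, cov[B i s, B j t; P] =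
    if i = j then
      1 / 2 * ((s : ℝ) ^ (2 * h) + (t : ℝ) ^ (2 * h) - |(s : ℝ) - t| ^ (2 * h))
    else 0

end MittagLeffler

end

/-!
Put `a = 1 / Γ(β + 1)` and `b = 1 / Γ(2 β + 1)`.

**The random variables `⟨·, η⟩`.** The second-order behaviour at `0` of the characteristic function
of `⟨·, φ⟩` shows that `⟨·, φ⟩` has second moment `a |φ|²`
(`memLp_two_of_tendsto_integral_one_sub_cos`). Hence `φ ↦ ⟨·, φ⟩` extends to a multiple of a linear
isometry `H → L²(μ)`, whose values are the variables `⟨·, η⟩` (`pairing_eq`), and by density the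
characteristic function of `⟨·, η⟩` is `t ↦ E_β(-½ t² |η|²)` for all `η ∈ H`
(`charFun_map_pairingCLM`).

**Independence forces `β = 1`.** If `η` and `ξ` are orthonormal and `⟨·, η⟩`, `⟨·, ξ⟩` are
independent, then `E_β(-2u) = E_β(-u)²` for `u ≥ 0`. Comparing the coefficients of `u²` gives
`2 b = a²`, that is `2 Γ(β + 1)² = Γ(2 β + 1)`, and convexity of `log Γ` excludes this for
`0 < β < 1` (`eq_one_of_two_mul_Gamma_sq`).

**The case `β = 1`.** As `E_1 = exp`, every `⟨·, η⟩` is centred Gaussian with variance `|η|²`.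
Linear combinations of such variables are again of this form, so they are jointly Gaussian, with
covariance `⟨η, ξ⟩`, and orthogonality implies independence.

**Generalized grey Brownian motion.** With `p = (α - 1) / 2`, the function `M^{α/2}_- 1_{[0,t)}` is
a constant times the Mandelbrot-van Ness kernel `(t - x)_+^p - (-x)_+^p` (`fracOpMinus_indicator`).
By scaling and translation, its inner products reduce to the `L²`-norm at time `1`, which an explicit
primitive turns into a Beta integral (`mandelbrotVanNess_constant`); the normalisation of
`M^{α/2}_-` makes this norm equal to `1`. So the inner products of the kernels are the
covariances of fractional Brownian motion (`inner_ggbmKernel`), and the kernels of the components at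
time `1` are orthonormal; the equivalences follow from the two preceding paragraphs.
-/

namespace MittagLeffler

universe u v

/-! ### The Mittag-Leffler function -/

theorem log_Gamma_add_le {x β : ℝ} (hx : 1 < x) (hβ : 0 < β) :
    Real.log (Real.Gamma x) + β * Real.log (x - 1) ≤ Real.log (Real.Gamma (x + β)) := by
  have h := (convexOn_iff_slope_mono_adjacent.mp Real.convexOn_log_Gamma).2
    (x := x - 1) (y := x) (z := x + β) (mem_Ioi.2 (by linarith)) (mem_Ioi.2 (by linarith))
    (by linarith) (by linarith)
  have hG : Real.log (Real.Gamma x) = Real.log (x - 1) + Real.log (Real.Gamma (x - 1)) := by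
    rw [← Real.log_mul (by linarith) (Real.Gamma_pos_of_pos (by linarith)).ne',
      ← Real.Gamma_add_one (by linarith), sub_add_cancel]
  simp only [Function.comp_apply, sub_sub_cancel, div_one, add_sub_cancel_left] at h
  rw [le_div_iff₀ hβ] at h
  nlinarith

theorem Gamma_mul_rpow_le {x β : ℝ} (hx : 1 < x) (hβ : 0 < β) :
    Real.Gamma x * (x - 1) ^ β ≤ Real.Gamma (x + β) := by
  have h1 := Real.Gamma_pos_of_pos (show 0 < x by linarith)
  have h2 := Real.rpow_pos_of_pos (show 0 < x - 1 by linarith) β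
  have h3 := Real.Gamma_pos_of_pos (show 0 < x + β by linarith)
  rw [← Real.log_le_log_iff (by positivity) h3, Real.log_mul h1.ne' h2.ne',
    Real.log_rpow (by linarith)]
  exact log_Gamma_add_le hx hβ

/-- The ratio test applies because `Γ(x + β) / Γ(x) → ∞`. -/
theorem summable_pow_div_Gamma {β : ℝ} (hβ : 0 < β) (R : ℝ) :
    Summable fun n : ℕ => R ^ n / Real.Gamma (β * n + 1) := by
  have hlim : Tendsto (fun n : ℕ => |R| * (β * n) ^ (-β)) atTop (𝓝 (|R| * 0)) :=
    ((tendsto_rpow_neg_atTop hβ).comp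
      (tendsto_natCast_atTop_atTop.const_mul_atTop hβ)).const_mul _
  rw [mul_zero] at hlim
  refine summable_of_ratio_norm_eventually_le (r := 1 / 2) (by norm_num) ?_
  filter_upwards [hlim.eventually_le_const (by norm_num : (0 : ℝ) < 1 / 2), eventually_gt_atTop 0]
    with n hn hn0
  have hpos : 0 < β * n := by positivity
  have hG := Gamma_mul_rpow_le (x := β * n + 1) (by linarith) hβ
  have h1 := Real.Gamma_pos_of_pos (show 0 < β * n + 1 by linarith)
  have h2 := Real.rpow_pos_of_pos hpos β
  rw [add_sub_cancel_right] at hG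
  have h3 : β * ((n + 1 : ℕ) : ℝ) + 1 = β * n + 1 + β := by push_cast; ring
  rw [h3, norm_div, norm_div, norm_pow, norm_pow, Real.norm_eq_abs, Real.norm_of_nonneg h1.le,
    Real.norm_of_nonneg (Real.Gamma_pos_of_pos (by linarith)).le]
  rw [Real.rpow_neg hpos.le, ← div_eq_mul_inv] at hn
  calc |R| ^ (n + 1) / Real.Gamma (β * n + 1 + β)
      ≤ |R| ^ (n + 1) / (Real.Gamma (β * n + 1) * (β * n) ^ β) := by gcongr
    _ = |R| / (β * n) ^ β * (|R| ^ n / Real.Gamma (β * n + 1)) := by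
        field_simp; ring
    _ ≤ _ := by gcongr

theorem norm_mittagLefflerE_term {β : ℝ} (hβ : 0 < β) (z : ℂ) (n : ℕ) :
    ‖z ^ n / Complex.Gamma ((β : ℂ) * n + 1)‖ = ‖z‖ ^ n / Real.Gamma (β * n + 1) := by
  have h : (β : ℂ) * n + 1 = ((β * n + 1 : ℝ) : ℂ) := by push_cast; rfl
  rw [norm_div, norm_pow, h, Complex.Gamma_ofReal, Complex.norm_real, Real.norm_of_nonneg]
  exact (Real.Gamma_pos_of_pos (by positivity)).le

theorem summable_mittagLefflerE {β : ℝ} (hβ : 0 < β) (z : ℂ) :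
    Summable fun n : ℕ => z ^ n / Complex.Gamma ((β : ℂ) * n + 1) := by
  refine Summable.of_norm ?_
  simp_rw [norm_mittagLefflerE_term hβ]
  exact summable_pow_div_Gamma hβ _

theorem continuous_mittagLefflerE {β : ℝ} (hβ : 0 < β) : Continuous (mittagLefflerE β) := by
  rw [continuous_iff_continuousAt]
  intro z
  have hc : ContinuousOn (mittagLefflerE β) (Metric.ball 0 (‖z‖ + 1)) := by
    refine continuousOn_tsum (u := fun n : ℕ => (‖z‖ + 1) ^ n / Real.Gamma (β * n + 1))
      (fun n => by fun_prop) (summable_pow_div_Gamma hβ _) fun n w hw => ?_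
    rw [norm_mittagLefflerE_term hβ]
    have := (Real.Gamma_pos_of_pos (show 0 < β * n + 1 by positivity)).le
    gcongr
    exact (mem_ball_zero_iff.1 hw).le
  exact hc.continuousAt (Metric.isOpen_ball.mem_nhds (by simp))

theorem mittagLefflerE_one (z : ℂ) : mittagLefflerE 1 z = Complex.exp z := by
  rw [mittagLefflerE, Complex.exp_eq_exp_ℂ, NormedSpace.exp_eq_tsum_div]
  refine tsum_congr fun n => ?_
  rw [Complex.ofReal_one, one_mul, Complex.Gamma_nat_eq_factorial]

/-- The expansion of `E_β` at `0` to the second order. -/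
theorem exists_norm_mittagLefflerE_sub_le {β : ℝ} (hβ : 0 < β) :
    ∃ C : ℝ, 0 ≤ C ∧ ∀ z : ℂ, ‖z‖ ≤ 1 →
      ‖mittagLefflerE β z - (1 + z / Real.Gamma (β + 1) + z ^ 2 / Real.Gamma (2 * β + 1))‖ ≤
        C * ‖z‖ ^ 3 := by
  have hs : Summable fun n : ℕ => (1 : ℝ) ^ (n + 3) / Real.Gamma (β * (n + 3 : ℕ) + 1) :=
    (summable_nat_add_iff (f := fun n : ℕ => (1 : ℝ) ^ n / Real.Gamma (β * n + 1)) 3).2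
      (summable_pow_div_Gamma hβ 1)
  have hpos : ∀ n : ℕ, 0 < Real.Gamma (β * n + 1) := fun n =>
    Real.Gamma_pos_of_pos (by positivity)
  refine ⟨∑' n : ℕ, (1 : ℝ) ^ (n + 3) / Real.Gamma (β * (n + 3 : ℕ) + 1),
    tsum_nonneg fun n => div_nonneg (by positivity) (hpos (n + 3)).le, fun z hz => ?_⟩
  have h0 := (summable_mittagLefflerE hβ z).sum_add_tsum_nat_add 3
  have h1 : ∑ i ∈ Finset.range 3, z ^ i / Complex.Gamma ((β : ℂ) * i + 1) =
      1 + z / Real.Gamma (β + 1) + z ^ 2 / Real.Gamma (2 * β + 1) := by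
    simp [Finset.sum_range_succ, ← Complex.Gamma_ofReal, mul_comm]
  rw [mittagLefflerE, ← h0, h1, add_sub_cancel_left]
  refine tsum_of_norm_bounded (hs.hasSum.mul_right _) fun n => ?_
  rw [norm_mittagLefflerE_term hβ, one_pow, div_mul_eq_mul_div, one_mul]
  have := (hpos (n + 3)).le
  exact div_le_div_of_nonneg_right
    (pow_le_pow_of_le_one (norm_nonneg z) hz (Nat.le_add_left 3 n)) this

/-- Convexity of `log Γ` gives `2 Γ(β + 1)² ≥ Γ(2 β + 1)` for `0 < β ≤ 1`, with equality at `β = 1`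
only. -/
theorem eq_one_of_two_mul_Gamma_sq {β : ℝ} (hβ0 : 0 < β) (hβ1 : β ≤ 1)
    (h : 2 * Real.Gamma (β + 1) ^ 2 = Real.Gamma (2 * β + 1)) : β = 1 := by
  by_contra hne
  have hlt : β < 1 := lt_of_le_of_ne hβ1 hne
  have hG := Real.Gamma_pos_of_pos (show 0 < β + 1 by linarith)
  have hlog : Real.log 2 + 2 * Real.log (Real.Gamma (β + 1)) =
      Real.log (Real.Gamma (2 * β + 1)) := by
    rw [← h, Real.log_mul (by norm_num) (by positivity), Real.log_pow]; norm_cast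
  have h3 : Real.Gamma 3 = 2 := by simp [Nat.factorial]
  have h2 : Real.log (Real.Gamma (2 + β)) = Real.log (1 + β) + Real.log (Real.Gamma (β + 1)) := by
    rw [← Real.log_mul (by linarith) hG.ne', show 2 + β = (β + 1) + 1 by ring,
      Real.Gamma_add_one (by linarith), add_comm 1 β]
  -- convexity at `1 + β < 2 < 2 + β` gives `log Γ(1 + β) ≥ -(1 - β) log (1 + β)`
  have c1 := Real.convexOn_log_Gamma.2 (mem_Ioi.2 (show (0 : ℝ) < β + 1 by linarith))
    (mem_Ioi.2 (show (0 : ℝ) < 2 + β by linarith)) hβ0.le (show 0 ≤ 1 - β by linarith) (by ring)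
  -- convexity at `1 + β < 1 + 2 β < 3` and the hypothesis give `log Γ(1 + β) ≤ -(1 - β) log 2`
  have c2 := Real.convexOn_log_Gamma.2 (mem_Ioi.2 (show (0 : ℝ) < β + 1 by linarith))
    (mem_Ioi.2 (show (0 : ℝ) < 3 by norm_num))
    (div_nonneg (show 0 ≤ 2 - 2 * β by linarith) (show 0 ≤ 2 - β by linarith))
    (div_nonneg hβ0.le (show 0 ≤ 2 - β by linarith))
    (by rw [← add_div, div_eq_one_iff_eq (by linarith)]; ring)
  have e1 : β * (β + 1) + (1 - β) * (2 + β) = 2 := by ring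
  have hne2 : 2 - β ≠ 0 := by linarith
  have e2 : (2 - 2 * β) / (2 - β) * (β + 1) + β / (2 - β) * 3 = 2 * β + 1 := by
    field_simp; ring
  simp only [smul_eq_mul, Function.comp_apply, e1, e2, Real.Gamma_two, Real.log_one, h2, h3]
    at c1 c2
  rw [← hlog, div_mul_eq_mul_div, div_mul_eq_mul_div, ← add_div,
    le_div_iff₀ (by linarith)] at c2
  have c3 : Real.log (1 + β) < Real.log 2 := Real.log_lt_log (by linarith) (by linarith)
  nlinarith

/-- The functional equation of the exponential function singles out `β = 1`: it forces the first two
Taylor coefficients `1 / Γ(β + 1)`, `1 / Γ(2 β + 1)` of `E_β` to be those of an exponential. -/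
theorem eq_one_of_mittagLefflerE_two_mul {β : ℝ} (hβ0 : 0 < β) (hβ1 : β ≤ 1)
    (h : ∀ u : ℝ, 0 ≤ u → mittagLefflerE β ((-(2 * u) : ℝ) : ℂ) =
      mittagLefflerE β ((-u : ℝ) : ℂ) ^ 2) : β = 1 := by
  obtain ⟨C, hC, hE⟩ := exists_norm_mittagLefflerE_sub_le hβ0
  have hG1 := Real.Gamma_pos_of_pos (show 0 < β + 1 by linarith)
  have hG2 := Real.Gamma_pos_of_pos (show 0 < 2 * β + 1 by linarith)
  refine eq_one_of_two_mul_Gamma_sq hβ0 hβ1 ?_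
  set a : ℝ := 1 / Real.Gamma (β + 1) with ha
  set b : ℝ := 1 / Real.Gamma (2 * β + 1) with hb
  -- the remainders of the expansion of `E_β`
  set r : ℝ → ℂ := fun u => mittagLefflerE β ((-u : ℝ) : ℂ) - ((1 - a * u + b * u ^ 2 : ℝ) : ℂ)
    with hr
  have hrb : ∀ u : ℝ, 0 ≤ u → u ≤ 1 → ‖r u‖ ≤ C * u ^ 3 := by
    intro u hu0 hu1
    have := hE ((-u : ℝ) : ℂ) (by simpa [abs_of_nonneg hu0] using hu1)
    rw [Complex.norm_real, norm_neg, Real.norm_of_nonneg hu0] at this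
    convert this using 3
    rw [ha, hb]; push_cast; ring
  -- all terms of order at least three in `E_β(-2u) - E_β(-u)²` are bounded by a constant times `u³`
  have key : ∀ u : ℝ, 0 < u → u ≤ 1 / 2 →
      |2 * b - a ^ 2| ≤ (2 * a * b + b ^ 2 + 8 * C + 2 * C * (1 + a + b) + C ^ 2) * u := by
    intro u hu0 hu1
    have e := h u hu0.le
    have e1 : mittagLefflerE β ((-(2 * u) : ℝ) : ℂ) =
      r (2 * u) + ((1 - a * (2 * u) + b * (2 * u) ^ 2 : ℝ) : ℂ) := by rw [hr]; ring
    have e2 : mittagLefflerE β ((-u : ℝ) : ℂ) = r u + ((1 - a * u + b * u ^ 2 : ℝ) : ℂ) := by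
      rw [hr]; ring
    rw [e1, e2] at e
    have e3 : (((2 * b - a ^ 2) * u ^ 2 : ℝ) : ℂ) =
        ((-(2 * a * b) * u ^ 3 + b ^ 2 * u ^ 4 : ℝ) : ℂ) - r (2 * u) +
          2 * ((1 - a * u + b * u ^ 2 : ℝ) : ℂ) * r u + r u ^ 2 := by
      push_cast at e ⊢
      linear_combination e
    have hq : 0 < u ^ 2 := by positivity
    have ha0 : 0 < a := by positivity
    have hb0 : 0 < b := by positivity
    have n1 : ‖r (2 * u)‖ ≤ 8 * C * u ^ 3 :=
      (hrb _ (by linarith) (by linarith)).trans_eq (by ring)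
    have n2 := hrb u hu0.le (by linarith)
    have n3 : ‖((-(2 * a * b) * u ^ 3 + b ^ 2 * u ^ 4 : ℝ) : ℂ)‖ ≤
        (2 * a * b + b ^ 2) * u ^ 3 := by
      rw [Complex.norm_real, Real.norm_eq_abs]
      have : u ^ 4 ≤ u ^ 3 := pow_le_pow_of_le_one hu0.le (by linarith) (by norm_num)
      have hu3 : 0 < u ^ 3 := by positivity
      have : b ^ 2 * u ^ 4 ≤ b ^ 2 * u ^ 3 := by gcongr
      have : 0 < b ^ 2 * u ^ 4 := by positivity
      have : 0 < a * b * u ^ 3 := by positivity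
      rw [abs_le]; constructor <;> nlinarith
    have n4 : ‖((1 - a * u + b * u ^ 2 : ℝ) : ℂ)‖ ≤ 1 + a + b := by
      rw [Complex.norm_real, Real.norm_eq_abs]
      have : a * u ≤ a := mul_le_of_le_one_right ha0.le (by linarith)
      have : b * u ^ 2 ≤ b := mul_le_of_le_one_right hb0.le (by nlinarith)
      have : 0 < a * u := by positivity
      have : 0 < b * u ^ 2 := by positivity
      rw [abs_le]; constructor <;> linarith
    have n5 : ‖r u ^ 2‖ ≤ C ^ 2 * u ^ 3 := by
      rw [norm_pow]
      have : u ^ 6 ≤ u ^ 3 := pow_le_pow_of_le_one hu0.le (by linarith) (by norm_num)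
      calc ‖r u‖ ^ 2 ≤ (C * u ^ 3) ^ 2 := by gcongr
        _ = C ^ 2 * u ^ 6 := by ring
        _ ≤ _ := by gcongr
    have n6 : ‖2 * ((1 - a * u + b * u ^ 2 : ℝ) : ℂ) * r u‖ ≤ 2 * (1 + a + b) * (C * u ^ 3) := by
      rw [norm_mul, norm_mul, Complex.norm_two]
      gcongr
    have n7 := congrArg norm e3
    rw [Complex.norm_real, Real.norm_eq_abs, abs_mul, abs_of_pos hq] at n7
    have n8 : |2 * b - a ^ 2| * u ^ 2 ≤
        ((2 * a * b + b ^ 2 + 8 * C + 2 * C * (1 + a + b) + C ^ 2) * u) * u ^ 2 := by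
      rw [n7]
      refine (norm_add_le _ _).trans ((add_le_add ((norm_add_le _ _).trans
        (add_le_add ((norm_sub_le _ _).trans (add_le_add n3 n1)) n6)) n5).trans_eq ?_)
      ring
    exact le_of_mul_le_mul_right n8 hq
  have hlim : Tendsto (fun u : ℝ =>
      (2 * a * b + b ^ 2 + 8 * C + 2 * C * (1 + a + b) + C ^ 2) * u) (𝓝[>] 0) (𝓝 0) := by
    refine tendsto_nhdsWithin_of_tendsto_nhds ?_
    exact (Continuous.tendsto' (by fun_prop) _ _ (by simp))
  have h0 : |2 * b - a ^ 2| ≤ 0 := by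
    refine ge_of_tendsto hlim ?_
    filter_upwards [Ioo_mem_nhdsGT (show (0 : ℝ) < 1 / 2 by norm_num)] with u hu
    exact key u hu.1 hu.2.le
  have h1 : 2 * b = a ^ 2 := by linarith [abs_nonpos_iff.1 h0]
  rw [ha, hb] at h1
  field_simp at h1
  linarith

theorem mittagLefflerE_zero {β : ℝ} (hβ : 0 < β) : mittagLefflerE β 0 = 1 := by
  obtain ⟨C, -, h⟩ := exists_norm_mittagLefflerE_sub_le hβ
  have h0 := h 0 (by simp)
  simpa [sub_eq_zero] using h0

theorem hasDerivAt_mittagLefflerE_zero {β : ℝ} (hβ : 0 < β) :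
    HasDerivAt (mittagLefflerE β) (1 / Real.Gamma (β + 1) : ℝ) 0 := by
  obtain ⟨C, hC, h⟩ := exists_norm_mittagLefflerE_sub_le hβ
  rw [hasDerivAt_iff_isLittleO_nhds_zero]
  have hO : (fun z : ℂ => mittagLefflerE β (0 + z) - mittagLefflerE β 0 -
      z • ((1 / Real.Gamma (β + 1) : ℝ) : ℂ)) =O[𝓝 0] fun z : ℂ => z ^ 2 := by
    refine Asymptotics.IsBigO.of_bound (C + ‖((1 / Real.Gamma (2 * β + 1) : ℝ) : ℂ)‖) ?_
    filter_upwards [Metric.closedBall_mem_nhds (0 : ℂ) one_pos] with z hz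
    rw [mem_closedBall_zero_iff] at hz
    have e : mittagLefflerE β (0 + z) - mittagLefflerE β 0 -
        z • ((1 / Real.Gamma (β + 1) : ℝ) : ℂ) =
        (mittagLefflerE β z -
          (1 + z / Real.Gamma (β + 1) + z ^ 2 / Real.Gamma (2 * β + 1))) +
        ((1 / Real.Gamma (2 * β + 1) : ℝ) : ℂ) * z ^ 2 := by
      rw [zero_add, mittagLefflerE_zero hβ, smul_eq_mul]; push_cast; ring
    rw [e, add_mul, ← norm_mul]
    refine (norm_add_le _ _).trans (add_le_add_left ((h z hz).trans ?_) _)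
    rw [norm_pow]
    have : ‖z‖ ^ 3 ≤ ‖z‖ ^ 2 := pow_le_pow_of_le_one (norm_nonneg z) hz (by norm_num)
    gcongr
  exact hO.trans_isLittleO (Asymptotics.isLittleO_pow_id one_lt_two)

/-! ### Second moments and characteristic functions -/

theorem tendsto_two_mul_sq_mul_one_sub_cos (x : ℝ) :
    Tendsto (fun n : ℕ => 2 * ((n : ℝ) + 1) ^ 2 * (1 - Real.cos (x / (n + 1)))) atTop
      (𝓝 (x ^ 2)) := by
  -- `1 - cos y = 2 sin² (y / 2)`, and `sinc` is continuous with `sinc 0 = 1`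
  have e : ∀ n : ℕ, 2 * ((n : ℝ) + 1) ^ 2 * (1 - Real.cos (x / (n + 1))) =
      x ^ 2 * Real.sinc (x / 2 * (1 / ((n : ℝ) + 1))) ^ 2 := by
    intro n
    have hn : (n : ℝ) + 1 ≠ 0 := by positivity
    have h1 : Real.cos (x / (n + 1)) = 1 - 2 * Real.sin (x / 2 * (1 / ((n : ℝ) + 1))) ^ 2 := by
      rw [Real.sin_sq, show x / ((n : ℝ) + 1) = 2 * (x / 2 * (1 / ((n : ℝ) + 1))) by
        field_simp, Real.cos_two_mul]
      ring
    rcases eq_or_ne x 0 with rfl | hx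
    · simp
    rw [h1, Real.sinc_of_ne_zero (by positivity)]
    field_simp
    ring
  simp_rw [e]
  have h := (Real.continuous_sinc.tendsto 0).comp
    ((tendsto_one_div_add_atTop_nhds_zero_nat (𝕜 := ℝ)).const_mul (x / 2) |>.trans
      (by rw [mul_zero]))
  simpa using (h.pow 2).const_mul (x ^ 2)

/-- The second moment of a random variable is the second-order term at `0` of its characteristic
function; in particular it is finite as soon as this term exists. -/
theorem memLp_two_of_tendsto_integral_one_sub_cos {Ω : Type*} [MeasurableSpace Ω]
    {P : Measure Ω} [IsProbabilityMeasure P] {X : Ω → ℝ} (hX : Measurable X) {c : ℝ}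
    (h : Tendsto (fun n : ℕ => ∫ ω, 2 * ((n : ℝ) + 1) ^ 2 * (1 - Real.cos (X ω / (n + 1))) ∂P)
      atTop (𝓝 c)) :
    MemLp X 2 P ∧ ∫ ω, X ω ^ 2 ∂P = c := by
  set f : ℕ → Ω → ℝ := fun n ω => 2 * ((n : ℝ) + 1) ^ 2 * (1 - Real.cos (X ω / (n + 1))) with hf
  have hfm : ∀ n, Measurable (f n) := fun n => by fun_prop
  have hf0 : ∀ n ω, 0 ≤ f n ω := fun n ω =>
    mul_nonneg (by positivity) (by linarith [Real.cos_le_one (X ω / (n + 1))])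
  have hfX : ∀ n ω, f n ω ≤ X ω ^ 2 := by
    intro n ω
    have h1 := Real.one_sub_sq_div_two_le_cos (x := X ω / (n + 1))
    have hn : (0 : ℝ) < (n : ℝ) + 1 := by positivity
    calc f n ω ≤ 2 * ((n : ℝ) + 1) ^ 2 * ((X ω / (n + 1)) ^ 2 / 2) := by
          simp only [hf]; gcongr; linarith
      _ = X ω ^ 2 := by field_simp
  have hfi : ∀ n, Integrable (f n) P := by
    intro n
    refine Integrable.of_bound (hfm n).aestronglyMeasurable (2 * ((n : ℝ) + 1) ^ 2 * 2)
      (Eventually.of_forall fun ω => ?_)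
    rw [Real.norm_of_nonneg (hf0 n ω)]
    simp only [hf]
    gcongr
    linarith [Real.neg_one_le_cos (X ω / (n + 1))]
  have hlim : ∀ ω, Tendsto (fun n => f n ω) atTop (𝓝 (X ω ^ 2)) := fun ω =>
    tendsto_two_mul_sq_mul_one_sub_cos (X ω)
  -- Fatou's lemma gives a finite second moment, which then serves as a dominating function
  have hint : Integrable (fun ω => X ω ^ 2) P := by
    refine ⟨(hX.pow_const 2).aestronglyMeasurable, ?_⟩
    rw [hasFiniteIntegral_iff_ofReal (Eventually.of_forall fun ω => sq_nonneg _)]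
    have hfatou := lintegral_liminf_le (μ := P) (u := atTop)
      (f := fun n ω => ENNReal.ofReal (f n ω)) fun n => (hfm n).ennreal_ofReal
    have h1 : ∀ ω, liminf (fun n => ENNReal.ofReal (f n ω)) atTop = ENNReal.ofReal (X ω ^ 2) :=
      fun ω => (ENNReal.tendsto_ofReal (hlim ω)).liminf_eq
    have h2 : liminf (fun n => ∫⁻ ω, ENNReal.ofReal (f n ω) ∂P) atTop = ENNReal.ofReal c := by
      simp_rw [← ofReal_integral_eq_lintegral_ofReal (hfi _) (Eventually.of_forall (hf0 _))]
      exact (ENNReal.tendsto_ofReal h).liminf_eq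
    simp_rw [h1, h2] at hfatou
    exact hfatou.trans_lt ENNReal.ofReal_lt_top
  refine ⟨(memLp_two_iff_integrable_sq hX.aestronglyMeasurable).2 hint, ?_⟩
  refine tendsto_nhds_unique (tendsto_integral_of_dominated_convergence _
    (fun n => (hfm n).aestronglyMeasurable) hint (fun n => Eventually.of_forall fun ω => ?_)
    (Eventually.of_forall hlim)) h
  rw [Real.norm_of_nonneg (hf0 n ω)]
  exact hfX n ω

/-- Characteristic functions depend continuously on the random variable in `L²`. -/
theorem continuous_integral_exp_Lp {Ω : Type*} [MeasurableSpace Ω] (P : Measure Ω)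
    [IsProbabilityMeasure P] :
    Continuous fun f : Lp ℝ 2 P => ∫ ω, Complex.exp (Complex.I * (f ω : ℂ)) ∂P := by
  have hint : ∀ f : Lp ℝ 2 P, Integrable (fun ω => Complex.exp (Complex.I * (f ω : ℂ))) P := by
    intro f
    refine Integrable.of_bound (C := 1) ?_ (Eventually.of_forall fun ω => ?_)
    · have := (Lp.stronglyMeasurable f).measurable
      exact (by fun_prop : Measurable _).aestronglyMeasurable
    · rw [mul_comm, Complex.norm_exp_ofReal_mul_I]
  -- `|exp (i x) - exp (i y)| ≤ |x - y|`, and the `L¹`-norm is at most the `L²`-norm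
  refine (LipschitzWith.of_dist_le_mul (K := 1) fun f g => ?_).continuous
  rw [dist_eq_norm, ← integral_sub (hint f) (hint g), NNReal.coe_one, one_mul, dist_eq_norm]
  have hfg : Integrable (f - g : Lp ℝ 2 P) P := (Lp.memLp (f - g)).integrable one_le_two
  calc ‖∫ ω, Complex.exp (Complex.I * (f ω : ℂ)) - Complex.exp (Complex.I * (g ω : ℂ)) ∂P‖
      ≤ ∫ ω, ‖(f - g : Lp ℝ 2 P) ω‖ ∂P := by
        refine norm_integral_le_of_norm_le hfg.norm ?_
        filter_upwards [Lp.coeFn_sub f g] with ω hω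
        have e : Complex.exp (Complex.I * (f ω : ℂ)) - Complex.exp (Complex.I * (g ω : ℂ)) =
            Complex.exp ((g ω : ℂ) * Complex.I) *
              (Complex.exp (Complex.I * ((f ω - g ω : ℝ) : ℂ)) - 1) := by
          rw [mul_sub, ← Complex.exp_add, mul_one, mul_comm (g ω : ℂ)]
          congr 2
          push_cast; ring
        rw [e, norm_mul, Complex.norm_exp_ofReal_mul_I, one_mul, hω]
        exact Real.norm_exp_I_mul_ofReal_sub_one_le
    _ = (eLpNorm (f - g : Lp ℝ 2 P) 1 P).toReal := by
        rw [integral_norm_eq_lintegral_enorm (Lp.aestronglyMeasurable _),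
          eLpNorm_one_eq_lintegral_enorm]
    _ ≤ (eLpNorm (f - g : Lp ℝ 2 P) 2 P).toReal :=
        ENNReal.toReal_mono (Lp.eLpNorm_ne_top _)
          (eLpNorm_le_eLpNorm_of_exponent_le one_le_two (Lp.aestronglyMeasurable _))
    _ = ‖f - g‖ := (Lp.norm_def _).symm

/-! ### The random variables `⟨·, η⟩` -/

section

variable {N : Type u} [AddCommGroup N] [Module ℝ N] [TopologicalSpace N]
  {H : Type v} [NormedAddCommGroup H] [InnerProductSpace ℝ H]
  {β : ℝ} {incl : N →L[ℝ] H} {μ : Measure (WeakDual ℝ N)}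

theorem measurable_dual_apply (φ : N) : Measurable fun ω : WeakDual ℝ N => ω φ := by
  intro A hA
  refine MeasurableSpace.measurableSet_generateFrom
    ⟨1, fun _ => φ, {x | x 0 ∈ A}, measurable_pi_apply 0 hA, rfl⟩

namespace IsMittagLefflerMeasure

theorem integral_exp_smul (h : IsMittagLefflerMeasure β incl μ) (φ : N) (t : ℝ) :
    ∫ ω, Complex.exp (Complex.I * ((t * ω φ : ℝ) : ℂ)) ∂μ =
      mittagLefflerE β ((-(t ^ 2 / 2 * ‖incl φ‖ ^ 2) : ℝ) : ℂ) := by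
  have h1 := h.charFun_eq (t • φ)
  have e : -(1 / 2) * inner ℝ (incl (t • φ)) (incl (t • φ)) = -(t ^ 2 / 2 * ‖incl φ‖ ^ 2) := by
    rw [real_inner_self_eq_norm_sq, map_smul, norm_smul, mul_pow, Real.norm_eq_abs, sq_abs]
    ring
  rw [e] at h1
  simpa only [map_smul, smul_eq_mul] using h1

theorem integral_cos_smul (h : IsMittagLefflerMeasure β incl μ) (φ : N) (t : ℝ) :
    ∫ ω, Real.cos (t * ω φ) ∂μ =
      (mittagLefflerE β ((-(t ^ 2 / 2 * ‖incl φ‖ ^ 2) : ℝ) : ℂ)).re := by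
  have := h.isProbabilityMeasure
  have hm := measurable_dual_apply φ
  have hint : Integrable (fun ω : WeakDual ℝ N =>
      Complex.exp (Complex.I * ((t * ω φ : ℝ) : ℂ))) μ := by
    refine Integrable.of_bound (C := 1) (Complex.measurable_exp.comp
      ((Complex.measurable_ofReal.comp (hm.const_mul t)).const_mul _)).aestronglyMeasurable
      (Eventually.of_forall fun ω => ?_)
    rw [mul_comm, Complex.norm_exp_ofReal_mul_I]
  rw [← h.integral_exp_smul, ← Complex.reCLM_apply, ← Complex.reCLM.integral_comp_comm hint]
  refine integral_congr_ae (Eventually.of_forall fun ω => ?_)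
  simp only [Complex.reCLM_apply]
  rw [mul_comm Complex.I, Complex.exp_ofReal_mul_I_re]

/-- The second moment is read off the derivative of `s ↦ E_β(-½ s |φ|²)` at `s = 0`, evaluated along
`s = (n + 1)⁻²`. -/
theorem memLp_apply_and_integral_sq (h : IsMittagLefflerMeasure β incl μ) (hβ : 0 < β) (φ : N) :
    MemLp (fun ω : WeakDual ℝ N => ω φ) 2 μ ∧
      ∫ ω, (ω φ) ^ 2 ∂μ = ‖incl φ‖ ^ 2 / Real.Gamma (β + 1) := by
  have := h.isProbabilityMeasure
  have hm := measurable_dual_apply φ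
  refine memLp_two_of_tendsto_integral_one_sub_cos hm ?_
  set q := ‖incl φ‖ ^ 2 with hq
  have hd : HasDerivAt (fun s : ℝ => (mittagLefflerE β ((-(s / 2 * q) : ℝ) : ℂ)).re)
      ((1 / Real.Gamma (β + 1)) * (-(1 / 2 * q))) 0 := by
    have h1 : HasDerivAt (fun x : ℝ => (mittagLefflerE β (x : ℂ)).re)
        (1 / Real.Gamma (β + 1)) (-(0 / 2 * q)) := by
      have h0 : ((-(0 / 2 * q) : ℝ) : ℂ) = 0 := by simp
      have := HasDerivAt.real_of_complex (z := -(0 / 2 * q))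
        (e := mittagLefflerE β) (e' := ((1 / Real.Gamma (β + 1) : ℝ) : ℂ))
        (by rw [h0]; exact hasDerivAt_mittagLefflerE_zero hβ)
      simpa using this
    have h2 : HasDerivAt (fun s : ℝ => -(s / 2 * q)) (-(1 / 2 * q)) 0 :=
      (((hasDerivAt_id (0 : ℝ)).div_const 2).mul_const q).neg
    exact HasDerivAt.comp (0 : ℝ) h1 h2
  have hs := hd.tendsto_slope_zero
  have hseq : Tendsto (fun n : ℕ => (1 / ((n : ℝ) + 1)) ^ 2) atTop (𝓝[≠] 0) := by
    refine tendsto_nhdsWithin_iff.2 ⟨?_, Eventually.of_forall fun n => ?_⟩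
    · simpa using (tendsto_one_div_add_atTop_nhds_zero_nat (𝕜 := ℝ)).pow 2
    · simp only [mem_compl_iff, mem_singleton_iff]
      positivity
  have hlim := (hs.comp hseq).const_mul (-2)
  convert hlim using 1
  · funext n
    have hn : (n : ℝ) + 1 ≠ 0 := by positivity
    have hc : Integrable (fun ω : WeakDual ℝ N => Real.cos (ω φ / (n + 1))) μ := by
      refine Integrable.of_bound (C := 1)
        (Real.measurable_cos.comp (hm.div_const _)).aestronglyMeasurable
        (Eventually.of_forall fun ω => ?_)
      exact Real.abs_cos_le_one _
    have e : ∫ ω, Real.cos (ω φ / (n + 1)) ∂μ =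
        (mittagLefflerE β ((-((1 / ((n : ℝ) + 1)) ^ 2 / 2 * q) : ℝ) : ℂ)).re := by
      rw [hq, ← h.integral_cos_smul]
      simp_rw [one_div_mul_eq_div]
    rw [integral_const_mul, integral_sub (integrable_const _) hc, e]
    simp [mittagLefflerE_zero hβ]
    field_simp
    ring
  · ring_nf

/-- The linear map `φ ↦ ⟨·, φ⟩` from `N` to `L²(μ)`. -/
noncomputable def applyL2 (h : IsMittagLefflerMeasure β incl μ) (hβ : 0 < β) :
    N →ₗ[ℝ] Lp ℝ 2 μ where
  toFun φ := toL2 μ fun ω : WeakDual ℝ N => ω φ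
  map_add' φ ψ := by
    simp only [toL2, dif_pos (h.memLp_apply_and_integral_sq hβ _).1, map_add]
    exact MemLp.toLp_add _ _
  map_smul' c φ := by
    simp only [toL2, dif_pos (h.memLp_apply_and_integral_sq hβ _).1, map_smul]
    exact MemLp.toLp_const_smul c (h.memLp_apply_and_integral_sq hβ φ).1

theorem coeFn_applyL2 (h : IsMittagLefflerMeasure β incl μ) (hβ : 0 < β) (φ : N) :
    h.applyL2 hβ φ =ᵐ[μ] fun ω => ω φ := by
  have := (h.memLp_apply_and_integral_sq hβ φ).1.coeFn_toLp
  simpa only [applyL2, toL2, LinearMap.coe_mk, AddHom.coe_mk,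
    dif_pos (h.memLp_apply_and_integral_sq hβ φ).1] using this

theorem norm_sq_applyL2 (h : IsMittagLefflerMeasure β incl μ) (hβ : 0 < β) (φ : N) :
    ‖h.applyL2 hβ φ‖ ^ 2 = ‖incl φ‖ ^ 2 / Real.Gamma (β + 1) := by
  rw [← (h.memLp_apply_and_integral_sq hβ φ).2, ← real_inner_self_eq_norm_sq, L2.inner_def]
  refine integral_congr_ae ?_
  filter_upwards [h.coeFn_applyL2 hβ φ] with ω hω
  rw [hω, real_inner_self_eq_norm_sq, Real.norm_eq_abs, sq_abs]

theorem norm_applyL2 (h : IsMittagLefflerMeasure β incl μ) (hβ : 0 < β) (φ : N) :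
    ‖h.applyL2 hβ φ‖ = √(1 / Real.Gamma (β + 1)) * ‖incl φ‖ := by
  rw [← Real.sqrt_sq (norm_nonneg (h.applyL2 hβ φ)), h.norm_sq_applyL2, div_eq_mul_one_div,
    mul_comm, Real.sqrt_mul' _ (sq_nonneg _), Real.sqrt_sq (norm_nonneg _)]

/-- The random variables `⟨·, η⟩`, as a bounded operator from `H` to `L²(μ)`. -/
noncomputable def pairingCLM (h : IsMittagLefflerMeasure β incl μ) (hβ : 0 < β) :
    H →L[ℝ] Lp ℝ 2 μ :=
  (h.applyL2 hβ).extendOfNorm (incl : N →ₗ[ℝ] H)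

theorem pairingCLM_incl (h : IsMittagLefflerMeasure β incl μ) (hβ : 0 < β)
    (hd : DenseRange incl) (φ : N) : h.pairingCLM hβ (incl φ) = h.applyL2 hβ φ :=
  LinearMap.extendOfNorm_eq (e := (incl : N →ₗ[ℝ] H)) hd
    ⟨_, fun φ => (h.norm_applyL2 hβ φ).le⟩ φ

/-- The limit that defines `⟨·, η⟩` exists, so that `pairing` takes no junk value here. -/
theorem pairing_eq (h : IsMittagLefflerMeasure β incl μ) (hβ : 0 < β)
    (hd : DenseRange incl) (η : H) : pairing incl μ η = h.pairingCLM hβ η := by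
  have hne : (comap incl (𝓝 η)).NeBot :=
    comap_neBot_iff_frequently.2 (mem_closure_iff_frequently.1 (hd η))
  refine Tendsto.limUnder_eq ?_
  have : Tendsto (fun φ => h.pairingCLM hβ (incl φ)) (comap incl (𝓝 η))
      (𝓝 (h.pairingCLM hβ η)) :=
    ((h.pairingCLM hβ).continuous.tendsto η).comp tendsto_comap
  simp only [h.pairingCLM_incl hβ hd] at this
  exact this

theorem norm_sq_pairingCLM (h : IsMittagLefflerMeasure β incl μ) (hβ : 0 < β)
    (hd : DenseRange incl) (η : H) :
    ‖h.pairingCLM hβ η‖ ^ 2 = ‖η‖ ^ 2 / Real.Gamma (β + 1) := by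
  refine hd.induction_on (p := fun η => ‖h.pairingCLM hβ η‖ ^ 2 = ‖η‖ ^ 2 / Real.Gamma (β + 1)) η
    (isClosed_eq (by fun_prop) (by fun_prop)) fun φ => ?_
  rw [h.pairingCLM_incl hβ hd, h.norm_sq_applyL2]

theorem integral_exp_pairingCLM (h : IsMittagLefflerMeasure β incl μ) (hβ : 0 < β)
    (hd : DenseRange incl) (η : H) :
    ∫ ω, Complex.exp (Complex.I * (h.pairingCLM hβ η ω : ℂ)) ∂μ =
      mittagLefflerE β ((-(‖η‖ ^ 2 / 2) : ℝ) : ℂ) := by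
  have := h.isProbabilityMeasure
  refine hd.induction_on (p := fun η =>
    ∫ ω, Complex.exp (Complex.I * (h.pairingCLM hβ η ω : ℂ)) ∂μ =
      mittagLefflerE β ((-(‖η‖ ^ 2 / 2) : ℝ) : ℂ)) η
    (isClosed_eq ((continuous_integral_exp_Lp μ).comp (h.pairingCLM hβ).continuous)
      ((continuous_mittagLefflerE hβ).comp (by fun_prop))) fun φ => ?_
  have h1 := h.integral_exp_smul φ 1
  rw [h.pairingCLM_incl hβ hd]
  convert h1 using 1
  · refine integral_congr_ae ?_
    filter_upwards [h.coeFn_applyL2 hβ φ] with ω hω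
    rw [hω, one_mul]
  · congr 3; ring

theorem charFun_map_pairingCLM (h : IsMittagLefflerMeasure β incl μ) (hβ : 0 < β)
    (hd : DenseRange incl) (η : H) (t : ℝ) :
    charFun (μ.map (h.pairingCLM hβ η)) t =
      mittagLefflerE β ((-(t ^ 2 * ‖η‖ ^ 2 / 2) : ℝ) : ℂ) := by
  rw [charFun_apply_real, integral_map (Lp.stronglyMeasurable _).measurable.aemeasurable
    (by fun_prop)]
  have h1 := h.integral_exp_pairingCLM hβ hd (t • η)
  rw [norm_smul, mul_pow, Real.norm_eq_abs, sq_abs] at h1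
  rw [← h1, map_smul]
  refine integral_congr_ae ?_
  filter_upwards [Lp.coeFn_smul t (h.pairingCLM hβ η)] with ω hω
  rw [hω, Pi.smul_apply, smul_eq_mul]
  congr 1
  push_cast; ring

end IsMittagLefflerMeasure

end

/-! ### Independence and Gaussianity -/

section

variable {N : Type u} [AddCommGroup N] [Module ℝ N] [TopologicalSpace N]
  {H : Type v} [NormedAddCommGroup H] [InnerProductSpace ℝ H]
  {β : ℝ} {incl : N →L[ℝ] H} {μ : Measure (WeakDual ℝ N)}

namespace IsMittagLefflerMeasure

/-- Independence of two such variables reads `E_β(-2u) = E_β(-u)²`, because `|η + ξ|² = 2`. -/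
theorem eq_one_of_indepFun_pairing (h : IsMittagLefflerMeasure β incl μ) (hβ0 : 0 < β)
    (hβ1 : β ≤ 1) (hd : DenseRange incl) {η ξ : H} (hη : ‖η‖ = 1) (hξ : ‖ξ‖ = 1)
    (hηξ : inner ℝ η ξ = 0) (hind : IndepFun (pairing incl μ η) (pairing incl μ ξ) μ) :
    β = 1 := by
  have := h.isProbabilityMeasure
  refine eq_one_of_mittagLefflerE_two_mul hβ0 hβ1 fun u hu => ?_
  rw [h.pairing_eq hβ0 hd, h.pairing_eq hβ0 hd] at hind
  have h1 := congrFun (hind.charFun_map_add_eq_mul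
    (Lp.stronglyMeasurable _).measurable.aemeasurable
    (Lp.stronglyMeasurable _).measurable.aemeasurable) √(2 * u)
  rw [← Measure.map_congr (Lp.coeFn_add _ _), ← map_add, Pi.mul_apply] at h1
  simp only [h.charFun_map_pairingCLM hβ0 hd] at h1
  have h2 : ‖η + ξ‖ ^ 2 = 2 := by
    rw [norm_add_sq_real, hη, hξ, hηξ]; norm_num
  rw [h2, hη, hξ, Real.sq_sqrt (by positivity)] at h1
  convert h1 using 1
  · congr 3; ring
  · rw [sq]; congr 4 <;> ring

theorem map_pairing_eq_gaussianReal (h : IsMittagLefflerMeasure 1 incl μ)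
    (hd : DenseRange incl) (η : H) :
    μ.map (pairing incl μ η) = gaussianReal 0 (‖η‖₊ ^ 2) := by
  have := h.isProbabilityMeasure
  have : IsProbabilityMeasure (μ.map (pairing incl μ η)) :=
    Measure.isProbabilityMeasure_map (Lp.stronglyMeasurable _).measurable.aemeasurable
  refine Measure.ext_of_charFun (funext fun t => ?_)
  rw [h.pairing_eq one_pos hd, h.charFun_map_pairingCLM one_pos hd, mittagLefflerE_one,
    charFun_gaussianReal]
  congr 1
  push_cast
  ring

theorem isGaussianProcess_pairing (h : IsMittagLefflerMeasure 1 incl μ)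
    (hd : DenseRange incl) {ι : Type*} (η : ι → H) :
    IsGaussianProcess (fun i => (pairing incl μ (η i) : WeakDual ℝ N → ℝ)) μ := by
  classical
  refine ⟨fun I => ⟨isGaussian_of_map_eq_gaussianReal fun L => ?_⟩⟩
  have hm : Measurable fun ω : WeakDual ℝ N =>
      I.restrict (fun i => (pairing incl μ (η i) : WeakDual ℝ N → ℝ) ω) :=
    measurable_pi_iff.2 fun i => (Lp.stronglyMeasurable _).measurable
  set c : I → ℝ := fun i => L fun j => if i = j then 1 else 0 with hc
  -- a linear combination of the `⟨·, η i⟩` is again of the form `⟨·, ζ⟩`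
  refine ⟨0, ‖∑ i : I, c i • η i‖₊ ^ 2, ?_⟩
  rw [← h.map_pairing_eq_gaussianReal hd, Measure.map_map L.continuous.measurable hm]
  refine Measure.map_congr ?_
  have hsum := Lp.coeFn_finsetSum (p := 2) (μ := μ) Finset.univ
    fun i : I => c i • h.pairingCLM one_pos (η i)
  have hsmul : ∀ᵐ ω ∂μ, ∀ i : I, (c i • h.pairingCLM one_pos (η i) : Lp ℝ 2 μ) ω =
      c i * h.pairingCLM one_pos (η i) ω := by
    rw [ae_all_iff]
    intro i
    filter_upwards [Lp.coeFn_smul (c i) (h.pairingCLM one_pos (η i))] with ω hω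
    rw [hω, Pi.smul_apply, smul_eq_mul]
  simp only [h.pairing_eq one_pos hd, map_sum, map_smul]
  filter_upwards [hsum, hsmul] with ω h1 h2
  rw [h1, Finset.sum_apply, Function.comp_apply]
  simp only [h2]
  refine (LinearMap.pi_apply_eq_sum_univ (L : (I → ℝ) →ₗ[ℝ] ℝ) _).trans
    (Finset.sum_congr rfl fun i _ => ?_)
  rw [smul_eq_mul, mul_comm]
  rfl

theorem integral_pairing (h : IsMittagLefflerMeasure 1 incl μ)
    (hd : DenseRange incl) (η : H) : ∫ ω, pairing incl μ η ω ∂μ = 0 := by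
  have h1 := integral_map (μ := μ) (φ := pairing incl μ η)
    (Lp.stronglyMeasurable _).measurable.aemeasurable (f := fun x : ℝ => x)
    (by fun_prop)
  rw [← h1, h.map_pairing_eq_gaussianReal hd, integral_id_gaussianReal]

theorem covariance_pairing (h : IsMittagLefflerMeasure 1 incl μ)
    (hd : DenseRange incl) (η ξ : H) :
    cov[pairing incl μ η, pairing incl μ ξ; μ] = inner ℝ η ξ := by
  have := h.isProbabilityMeasure
  have hn : ∀ ζ : H, ‖h.pairingCLM one_pos ζ‖ ^ 2 = ‖ζ‖ ^ 2 := fun ζ => by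
    rw [h.norm_sq_pairingCLM one_pos hd, one_add_one_eq_two, Real.Gamma_two, div_one]
  have hi : inner ℝ (h.pairingCLM one_pos η) (h.pairingCLM one_pos ξ) = inner ℝ η ξ := by
    have h1 := norm_add_sq_real (h.pairingCLM one_pos η) (h.pairingCLM one_pos ξ)
    rw [← map_add, hn, hn, hn, norm_add_sq_real] at h1
    linarith
  rw [covariance_eq_sub (Lp.memLp _) (Lp.memLp _), h.integral_pairing hd, zero_mul, sub_zero,
    ← hi, L2.inner_def, h.pairing_eq one_pos hd, h.pairing_eq one_pos hd]
  refine integral_congr_ae (Eventually.of_forall fun ω => ?_)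
  simp [mul_comm]

theorem iIndepFun_pairing_iff (h : IsMittagLefflerMeasure β incl μ) (hβ0 : 0 < β)
    (hβ1 : β ≤ 1) (hd : DenseRange incl) {n : ℕ} (hn : 1 ≤ n) {φ : Fin n → H}
    (hφ : Orthonormal ℝ φ) :
    iIndepFun (fun (i : Fin n) (ω : WeakDual ℝ N) => pairing incl μ (φ i) ω) μ ↔
      n = 1 ∨ β = 1 := by
  have := h.isProbabilityMeasure
  constructor
  · intro hind
    by_contra! hne
    have h01 : (⟨0, by omega⟩ : Fin n) ≠ ⟨1, by omega⟩ := by simp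
    exact hne.2 (h.eq_one_of_indepFun_pairing hβ0 hβ1 hd (hφ.1 _) (hφ.1 _) (hφ.2 h01)
      (hind.indepFun h01))
  · rintro (rfl | rfl)
    · exact iIndepFun.of_subsingleton
    · have hG : IsGaussianProcess
        (fun (p : (_ : Fin n) × Unit) => (pairing incl μ (φ p.1) : WeakDual ℝ N → ℝ)) μ :=
        h.isGaussianProcess_pairing hd fun p : (_ : Fin n) × Unit => φ p.1
      have hI := IsGaussianProcess.iIndepFun_of_covariance_eq_zero
        (X := fun i (_ : Unit) => (pairing incl μ (φ i) : WeakDual ℝ N → ℝ)) hG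
        (fun i _ => (Lp.stronglyMeasurable _).measurable.aemeasurable)
        (fun i j hij _ _ => by rw [h.covariance_pairing hd, hφ.2 hij])
      exact hI.comp (fun _ x => x ()) fun _ => measurable_pi_apply ()

end IsMittagLefflerMeasure

end

/-! ### The Beta integral and the Mandelbrot-van Ness constant -/

theorem integral_Ioo_rpow_mul_one_sub_rpow {a b : ℝ} (ha : 0 < a) (hb : 0 < b) :
    ∫ x in Ioo (0 : ℝ) 1, x ^ (a - 1) * (1 - x) ^ (b - 1) = beta a b := by
  rw [beta_eq_betaIntegralReal a b ha hb, Complex.betaIntegral,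
    intervalIntegral.integral_of_le zero_le_one, ← integral_Ioc_eq_integral_Ioo,
    ← RCLike.re_eq_complex_re, ← integral_re]
  · refine setIntegral_congr_fun measurableSet_Ioc fun x hx => ?_
    have h1 : (x : ℂ) ^ ((a : ℂ) - 1) = ((x ^ (a - 1) : ℝ) : ℂ) := by
      rw [Complex.ofReal_cpow hx.1.le]; norm_cast
    have h2 : (1 - (x : ℂ)) ^ ((b : ℂ) - 1) = (((1 - x) ^ (b - 1) : ℝ) : ℂ) := by
      rw [Complex.ofReal_cpow (by linarith [hx.2])]; norm_cast
    simp only [h1, h2, ← Complex.ofReal_mul]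
    rfl
  · have := Complex.betaIntegral_convergent (u := a) (v := b) (by simpa) (by simpa)
    rwa [intervalIntegrable_iff_integrableOn_Ioc_of_le zero_le_one] at this

/-- The Beta integral on the half-line. -/
theorem integral_Ioi_rpow_mul_one_add_rpow {a b : ℝ} (ha : 0 < a) (hb : 0 < b) :
    ∫ s in Ioi (0 : ℝ), s ^ (a - 1) * (1 + s) ^ (-(a + b)) = beta a b := by
  have himg : (fun s : ℝ => s / (1 + s)) '' Ioi 0 = Ioo 0 1 := by
    ext x
    simp only [mem_image, mem_Ioi, mem_Ioo]
    constructor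
    · rintro ⟨s, hs, rfl⟩
      exact ⟨by positivity, by rw [div_lt_one (by linarith)]; linarith⟩
    · rintro ⟨h0, h1⟩
      have : 1 - x ≠ 0 := by linarith
      refine ⟨x / (1 - x), div_pos h0 (by linarith), ?_⟩
      field_simp
      ring
  have hinj : InjOn (fun s : ℝ => s / (1 + s)) (Ioi 0) := by
    intro s hs t ht hst
    rw [mem_Ioi] at hs ht
    simp only at hst
    field_simp at hst
    linarith
  have hder : ∀ s ∈ Ioi (0 : ℝ),
      HasDerivWithinAt (fun s : ℝ => s / (1 + s)) (1 / (1 + s) ^ 2) (Ioi 0) s := by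
    intro s hs
    rw [mem_Ioi] at hs
    have := (hasDerivAt_id s).div ((hasDerivAt_id s).const_add 1) (by simp; linarith)
    refine (this.congr_deriv ?_).hasDerivWithinAt
    simp
  rw [← integral_Ioo_rpow_mul_one_sub_rpow ha hb, ← himg,
    integral_image_eq_integral_abs_deriv_smul measurableSet_Ioi hder hinj]
  refine setIntegral_congr_fun measurableSet_Ioi fun s hs => ?_
  rw [mem_Ioi] at hs
  have h1 : 1 - s / (1 + s) = (1 + s)⁻¹ := by field_simp; ring
  simp only [smul_eq_mul]
  rw [h1, abs_of_pos (by positivity), Real.div_rpow hs.le (by linarith),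
    Real.inv_rpow (by linarith), ← Real.rpow_neg (by linarith),
    div_eq_mul_inv (s ^ (a - 1)), ← Real.rpow_neg (by linarith), one_div,
    ← Real.rpow_natCast, ← Real.rpow_neg (by linarith)]
  have h2 : (1 + s) ^ (-(a + b)) =
      (1 + s) ^ (-((2 : ℕ) : ℝ)) * (1 + s) ^ (-(a - 1)) * (1 + s) ^ (-(b - 1)) := by
    rw [← Real.rpow_add (by linarith), ← Real.rpow_add (by linarith)]
    congr 1; push_cast; ring
  rw [h2]; ring

theorem integrableOn_Ioi_rpow_mul_one_add_rpow {a b : ℝ} (ha : 0 < a) (hb : 0 < b) :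
    IntegrableOn (fun s : ℝ => s ^ (a - 1) * (1 + s) ^ (-(a + b))) (Ioi 0) := by
  refine Integrable.of_integral_ne_zero ?_
  rw [integral_Ioi_rpow_mul_one_add_rpow ha hb]
  exact (beta_pos ha hb).ne'

section

variable {p : ℝ}

/-- The mean value theorem for powers with exponent at most `1`. -/
theorem abs_one_add_rpow_sub_rpow_le (hp : p ≤ 1) {s : ℝ} (hs : 0 < s) :
    |(1 + s) ^ p - s ^ p| ≤ |p| * s ^ (p - 1) := by
  have h := (convex_Icc s (1 + s)).norm_image_sub_le_of_norm_hasDerivWithin_le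
    (f := fun x : ℝ => x ^ p) (f' := fun x => p * x ^ (p - 1)) (C := |p| * s ^ (p - 1))
    (x := s) (y := 1 + s)
    (fun x hx => (Real.hasDerivAt_rpow_const (Or.inl (by linarith [hx.1]))).hasDerivWithinAt)
    (fun x hx => ?_) (left_mem_Icc.2 (by linarith)) (right_mem_Icc.2 (by linarith))
  · simpa using h
  · rw [norm_mul, Real.norm_eq_abs, Real.norm_of_nonneg (Real.rpow_nonneg (by linarith [hx.1]) _)]
    gcongr |p| * ?_
    exact Real.rpow_le_rpow_of_nonpos hs hx.1 (by linarith)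

theorem integrableOn_sq_one_add_rpow_sub_rpow (hp1 : -(1 / 2) < p) (hp2 : p < 1 / 2) :
    IntegrableOn (fun s : ℝ => ((1 + s) ^ p - s ^ p) ^ 2) (Ioi 0) := by
  rw [← Ioc_union_Ioi_eq_Ioi zero_le_one, integrableOn_union]
  have hm : Measurable fun s : ℝ => ((1 + s) ^ p - s ^ p) ^ 2 := by fun_prop
  constructor
  · have h1 : IntegrableOn (fun s : ℝ => 2 * ((1 + s) ^ (2 * p) + s ^ (2 * p))) (Ioc 0 1) := by
      refine (Integrable.add ?_ ?_).const_mul 2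
      · have : ContinuousOn (fun s : ℝ => (1 + s) ^ (2 * p)) (Icc 0 1) :=
          ContinuousOn.rpow_const (by fun_prop) fun s hs => Or.inl (by linarith [hs.1])
        exact (this.integrableOn_Icc).mono_set Ioc_subset_Icc_self
      · have := intervalIntegral.intervalIntegrable_rpow' (a := 0) (b := 1) (r := 2 * p)
          (by linarith)
        rwa [intervalIntegrable_iff_integrableOn_Ioc_of_le zero_le_one] at this
    refine h1.mono' hm.aestronglyMeasurable ?_
    filter_upwards [ae_restrict_mem measurableSet_Ioc] with s hs
    rw [Real.norm_of_nonneg (sq_nonneg _), mul_comm 2 p, Real.rpow_mul hs.1.le,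
      Real.rpow_mul (by linarith [hs.1]), Real.rpow_two, Real.rpow_two]
    nlinarith [sq_nonneg ((1 + s) ^ p + s ^ p)]
  · have h1 := (integrableOn_Ioi_rpow_of_lt (a := 2 * (p - 1)) (by linarith) one_pos).const_mul
      (|p| ^ 2)
    refine h1.mono' hm.aestronglyMeasurable ?_
    filter_upwards [ae_restrict_mem measurableSet_Ioi] with s hs
    have hs0 : 0 < s := lt_trans one_pos hs
    rw [Real.norm_of_nonneg (sq_nonneg _), mul_comm 2, Real.rpow_mul hs0.le, Real.rpow_two,
      ← mul_pow, ← sq_abs]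
    have := abs_one_add_rpow_sub_rpow_le (p := p) (by linarith) hs0
    gcongr

/-- A primitive of `(2 p + 1) ((1 + s)^p - s^p)²` up to the multiple
`(1 - p) s^p (1 + s)^{p - 2}` of the integrand of a Beta integral. The first three terms account for
the square and leave a multiple of `s^p (1 + s)^{p - 1}`, which the last term reduces to
`s^p (1 + s)^{p - 2}`. -/
noncomputable def sqPrimitive (p s : ℝ) : ℝ :=
  (1 + s) ^ (2 * p + 1) + s ^ (2 * p + 1) - 2 * (s ^ (p + 1) * (1 + s) ^ p)
    - s ^ (p + 1) * (1 + s) ^ (p - 1)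

theorem hasDerivAt_sqPrimitive {s : ℝ} (hs : 0 < s) :
    HasDerivAt (sqPrimitive p)
      ((2 * p + 1) * ((1 + s) ^ p - s ^ p) ^ 2 - (1 - p) * (s ^ p * (1 + s) ^ (p - 2))) s := by
  have hs1 : 0 < 1 + s := by linarith
  have d0 : ∀ q : ℝ, HasDerivAt (fun s : ℝ => s ^ q) (q * s ^ (q - 1)) s := fun q =>
    Real.hasDerivAt_rpow_const (Or.inl hs.ne')
  have d1 : ∀ q : ℝ, HasDerivAt (fun s : ℝ => (1 + s) ^ q) (q * (1 + s) ^ (q - 1)) s := fun q => by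
    have := (Real.hasDerivAt_rpow_const (x := 1 + s) (p := q) (Or.inl hs1.ne')).comp s
      ((hasDerivAt_id s).const_add 1)
    rw [mul_one] at this
    exact this
  have h := (((d1 (2 * p + 1)).add (d0 (2 * p + 1))).sub
    (((d0 (p + 1)).mul (d1 p)).const_mul 2)).sub ((d0 (p + 1)).mul (d1 (p - 1)))
  refine h.congr_deriv ?_
  -- express all the powers through `A = (1 + s)^(p - 2)` and `a = s^p`
  have e1 : (1 + s) ^ p = (1 + s) ^ (p - 2) * (1 + s) ^ 2 := by
    rw [← Real.rpow_natCast, ← Real.rpow_add hs1]; congr 1; push_cast; ring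
  have e2 : (1 + s) ^ (p - 1) = (1 + s) ^ (p - 2) * (1 + s) := by
    rw [← Real.rpow_add_one hs1.ne']; congr 1; ring
  have e3 : (1 + s) ^ (2 * p + 1 - 1) = ((1 + s) ^ (p - 2) * (1 + s) ^ 2) ^ 2 := by
    rw [← e1, ← Real.rpow_natCast ((1 + s) ^ p), ← Real.rpow_mul hs1.le]; congr 1; push_cast; ring
  have e4 : s ^ (2 * p + 1 - 1) = (s ^ p) ^ 2 := by
    rw [← Real.rpow_natCast (s ^ p), ← Real.rpow_mul hs.le]; congr 1; push_cast; ring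
  have e5 : s ^ (p + 1) = s ^ p * s := Real.rpow_add_one hs.ne' p
  have e6 : s ^ (p + 1 - 1) = s ^ p := by rw [add_sub_cancel_right]
  have e7 : (1 + s) ^ (p - 1 - 1) = (1 + s) ^ (p - 2) := by congr 1; ring
  rw [e3, e4, e5, e6, e7, e2, e1]
  ring

theorem continuousAt_sqPrimitive_zero (hp1 : -(1 / 2) < p) : ContinuousAt (sqPrimitive p) 0 := by
  have c0 : ∀ q : ℝ, 0 < q → ContinuousAt (fun s : ℝ => s ^ q) 0 := fun q hq =>
    Real.continuousAt_rpow_const _ _ (Or.inr hq.le)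
  have c1 : ∀ q : ℝ, ContinuousAt (fun s : ℝ => (1 + s) ^ q) 0 := fun q =>
    ContinuousAt.rpow_const (by fun_prop) (Or.inl (by simp))
  exact (((c1 _).add (c0 _ (by linarith))).sub
    (((c0 _ (by linarith)).mul (c1 _)).const_mul 2)).sub ((c0 _ (by linarith)).mul (c1 _))

theorem sqPrimitive_zero (hp1 : -(1 / 2) < p) : sqPrimitive p 0 = 1 := by
  have h1 : 2 * p + 1 ≠ 0 := by linarith
  have h2 : p + 1 ≠ 0 := by linarith
  simp [sqPrimitive, Real.zero_rpow h1, Real.zero_rpow h2]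

/-- The terms of `sqPrimitive p s` of order `s^{2 p + 1}` and `s^{2 p}` cancel: with `A = (1 + s)^p`
and `a = s^p` it equals `s (A - a)² + A (A - a) + a A / (1 + s)`, which is `O(s^{2 p - 1})`. -/
theorem tendsto_sqPrimitive_atTop (hp2 : p < 1 / 2) : Tendsto (sqPrimitive p) atTop (𝓝 0) := by
  have hlim : Tendsto (fun s : ℝ => (|p| ^ 2 + (1 + |p|) * |p| + (1 + |p|)) * s ^ (-(1 - 2 * p)))
      atTop (𝓝 ((|p| ^ 2 + (1 + |p|) * |p| + (1 + |p|)) * 0)) :=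
    (tendsto_rpow_neg_atTop (by linarith)).const_mul _
  rw [mul_zero] at hlim
  refine squeeze_zero_norm' ?_ hlim
  filter_upwards [eventually_ge_atTop 1] with s hs
  have hs0 : 0 < s := by linarith
  have hs1 : 0 < 1 + s := by linarith
  have e1 : (1 + s) ^ (2 * p + 1) = ((1 + s) ^ p) ^ 2 * (1 + s) := by
    rw [Real.rpow_add_one hs1.ne', mul_comm 2 p, Real.rpow_mul hs1.le, Real.rpow_two]
  have e2 : s ^ (2 * p + 1) = (s ^ p) ^ 2 * s := by
    rw [Real.rpow_add_one hs0.ne', mul_comm 2 p, Real.rpow_mul hs0.le, Real.rpow_two]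
  have e3 : s ^ (p + 1) = s ^ p * s := Real.rpow_add_one hs0.ne' p
  have e4 : (1 + s) ^ (p - 1) = (1 + s) ^ p / (1 + s) := Real.rpow_sub_one hs1.ne' p
  have e5 : s ^ (-(1 - 2 * p)) = (s ^ p) ^ 2 / s := by
    rw [← Real.rpow_two, ← Real.rpow_mul hs0.le, ← Real.rpow_sub_one hs0.ne']; congr 1; ring
  have hd := abs_one_add_rpow_sub_rpow_le (p := p) (by linarith) hs0
  rw [Real.rpow_sub_one hs0.ne'] at hd
  set A := (1 + s) ^ p
  set a := s ^ p
  have hA : 0 < A := Real.rpow_pos_of_pos hs1 _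
  have ha : 0 < a := Real.rpow_pos_of_pos hs0 _
  have e : sqPrimitive p s = s * (A - a) ^ 2 + A * (A - a) + a * A / (1 + s) := by
    rw [sqPrimitive, e1, e2, e3, e4]
    field_simp
    ring
  have hAa : A ≤ (1 + |p|) * a := by
    have h1 : |p| * (a / s) ≤ |p| * a := by
      gcongr; exact div_le_self ha.le hs
    linarith [le_abs_self (A - a)]
  rw [e5, e, Real.norm_eq_abs]
  have n1 : |s * (A - a) ^ 2| ≤ |p| ^ 2 * (a ^ 2 / s) := by
    rw [abs_mul, abs_of_pos hs0, abs_pow]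
    calc s * |A - a| ^ 2 ≤ s * (|p| * (a / s)) ^ 2 := by gcongr
      _ = |p| ^ 2 * (a ^ 2 / s) := by field_simp
  have n2 : |A * (A - a)| ≤ (1 + |p|) * |p| * (a ^ 2 / s) := by
    rw [abs_mul, abs_of_pos hA]
    calc A * |A - a| ≤ ((1 + |p|) * a) * (|p| * (a / s)) := by gcongr
      _ = _ := by ring
  have n3 : |a * A / (1 + s)| ≤ (1 + |p|) * (a ^ 2 / s) := by
    rw [abs_of_pos (by positivity)]
    calc a * A / (1 + s) ≤ a * ((1 + |p|) * a) / s := by gcongr; linarith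
      _ = _ := by ring
  refine (abs_add_three _ _ _).trans ?_
  rw [add_mul, add_mul]
  exact add_le_add (add_le_add n1 n2) n3

/-- At `∞` the primitive vanishes, at `0` it equals `1`, and the remaining integrand is that of the
Beta integral `B(p + 1, 1 - 2 p)`. -/
theorem integral_sq_one_add_rpow_sub_rpow (hp1 : -(1 / 2) < p) (hp2 : p < 1 / 2) :
    (2 * p + 1) * ∫ s in Ioi (0 : ℝ), ((1 + s) ^ p - s ^ p) ^ 2 =
      (1 - p) * beta (p + 1) (1 - 2 * p) - 1 := by
  have ha : 0 < p + 1 := by linarith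
  have hb : 0 < 1 - 2 * p := by linarith
  have e1 : p + 1 - 1 = p := by ring
  have e2 : -(p + 1 + (1 - 2 * p)) = p - 2 := by ring
  have hB := integral_Ioi_rpow_mul_one_add_rpow ha hb
  have hBi := integrableOn_Ioi_rpow_mul_one_add_rpow ha hb
  have hi := integrableOn_sq_one_add_rpow_sub_rpow hp1 hp2
  rw [e1, e2] at hB hBi
  have h := integral_Ioi_of_hasDerivAt_of_tendsto
    (continuousAt_sqPrimitive_zero hp1).continuousWithinAt
    (fun s hs => hasDerivAt_sqPrimitive (p := p) hs)
    ((hi.const_mul (2 * p + 1)).sub (hBi.const_mul (1 - p))) (tendsto_sqPrimitive_atTop hp2)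
  rw [integral_sub (hi.const_mul _) (hBi.const_mul _), integral_const_mul, integral_const_mul, hB,
    sqPrimitive_zero hp1] at h
  linarith

/-- Euler's reflection formula at `p` and at `2 p`, free of the singularity at `p = 0`. -/
theorem Gamma_mul_Gamma_mul_cos (hp1 : -(1 / 2) < p) (hp2 : p < 1 / 2) :
    Real.Gamma (1 - 2 * p) * Real.Gamma (2 * p + 1) * Real.cos (Real.pi * p) =
      Real.Gamma (p + 1) * Real.Gamma (1 - p) := by
  rcases eq_or_ne p 0 with rfl | hp
  · simp
  have h1 := Real.Gamma_mul_Gamma_one_sub p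
  have h2 := Real.Gamma_mul_Gamma_one_sub (2 * p)
  have hsin : Real.sin (Real.pi * p) ≠ 0 := by
    intro h0
    have hpi := Real.pi_pos
    have := (Real.sin_eq_zero_iff_of_lt_of_lt (by nlinarith) (by nlinarith)).1 h0
    rcases mul_eq_zero.1 this with h | h
    · exact hpi.ne' h
    · exact hp h
  have hcos : Real.cos (Real.pi * p) ≠ 0 := by
    refine (Real.cos_pos_of_mem_Ioo ⟨?_, ?_⟩).ne' <;> nlinarith [Real.pi_pos]
  rw [show Real.pi * (2 * p) = 2 * (Real.pi * p) by ring, Real.sin_two_mul] at h2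
  rw [Real.Gamma_add_one hp, Real.Gamma_add_one (by simpa using hp)]
  rw [show Real.Gamma (1 - 2 * p) * (2 * p * Real.Gamma (2 * p)) * Real.cos (Real.pi * p) =
    2 * p * Real.cos (Real.pi * p) * (Real.Gamma (2 * p) * Real.Gamma (1 - 2 * p)) by ring, h2,
    mul_assoc p, h1]
  generalize Real.cos (Real.pi * p) = c at *
  generalize Real.sin (Real.pi * p) = s at *
  field_simp

/-- The squared `L²`-norm of the Mandelbrot-van Ness kernel: the integral is the contribution of the
negative half-line, and `1 / (2 p + 1)` that of `[0, 1)`. -/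
theorem mandelbrotVanNess_constant (hp1 : -(1 / 2) < p) (hp2 : p < 1 / 2) :
    (∫ s in Ioi (0 : ℝ), ((1 + s) ^ p - s ^ p) ^ 2) + 1 / (2 * p + 1) =
      Real.Gamma (p + 1) ^ 2 / (Real.Gamma (2 * p + 2) * Real.cos (Real.pi * p)) := by
  have h := integral_sq_one_add_rpow_sub_rpow hp1 hp2
  have hG := Gamma_mul_Gamma_mul_cos hp1 hp2
  have hq : 2 * p + 1 ≠ 0 := by linarith
  have hcos : Real.cos (Real.pi * p) ≠ 0 := by
    refine (Real.cos_pos_of_mem_Ioo ⟨?_, ?_⟩).ne' <;> nlinarith [Real.pi_pos]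
  have g1 := (Real.Gamma_pos_of_pos (show 0 < 2 * p + 1 by linarith)).ne'
  have g2 := (Real.Gamma_pos_of_pos (show 0 < 1 - p by linarith)).ne'
  have hp1' : 1 - p ≠ 0 := by linarith
  rw [beta, show p + 1 + (1 - 2 * p) = (1 - p) + 1 by ring, Real.Gamma_add_one hp1'] at h
  rw [show 2 * p + 2 = (2 * p + 1) + 1 by ring, Real.Gamma_add_one hq,
    eq_div_iff (by positivity)]
  generalize Real.cos (Real.pi * p) = c at *
  field_simp at h ⊢
  set I := ∫ s in Ioi (0 : ℝ), ((1 + s) ^ p - s ^ p) ^ 2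
  have h3 : (I * (2 * p + 1) + 1) * Real.Gamma (1 - p) =
      Real.Gamma (p + 1) * Real.Gamma (1 - 2 * p) := by linarith
  refine mul_right_cancel₀ g2 ?_
  linear_combination (Real.Gamma (2 * p + 1) * c) * h3 +
    Real.Gamma (p + 1) * hG

end

/-! ### The Mandelbrot-van Ness kernel -/

/-- The truncated power `y_+^p`; it vanishes at `y = 0` for every `p`. -/
noncomputable def truncPow (p y : ℝ) : ℝ := if 0 < y then y ^ p else 0

/-- The Mandelbrot-van Ness kernel `x ↦ (t - x)_+^p - (-x)_+^p`. -/
noncomputable def mvnKernel (p t x : ℝ) : ℝ := truncPow p (t - x) - truncPow p (-x)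

/-! ### Fractional operators on indicator functions -/

/-- With half-lines to the left, both fractional operators act on each of the two terms
separately. -/
theorem indicator_Ico_eq_sub {t : ℝ} (ht : 0 ≤ t) (y : ℝ) :
    indicator (Ico (0 : ℝ) t) (fun _ => (1 : ℝ)) y =
      (if y < t then 1 else 0) - (if y < 0 then 1 else 0) := by
  by_cases h0 : y < 0
  · simp [h0, h0.trans_le ht]
  · by_cases h1 : y < t <;> simp [h0, h1, indicator, not_lt.1 h0]

theorem integral_Ioi_rpow_of_lt_truncPow {r : ℝ} (hr : 0 < r) (c : ℝ) :
    IntegrableOn (fun s : ℝ => if s < c then s ^ (r - 1) else 0) (Ioi 0) ∧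
    ∫ s in Ioi (0 : ℝ), (if s < c then s ^ (r - 1) else 0) = truncPow r c / r := by
  have e : (fun s : ℝ => if s < c then s ^ (r - 1) else 0) =
      indicator (Iio c) fun s => s ^ (r - 1) := by
    ext s; simp [indicator]
  have hset : Iio c ∩ Ioi (0 : ℝ) = Ioo 0 c := by rw [inter_comm, Ioi_inter_Iio]
  rw [e, IntegrableOn, integrable_indicator_iff measurableSet_Iio, IntegrableOn,
    Measure.restrict_restrict measurableSet_Iio, integral_indicator measurableSet_Iio,
    Measure.restrict_restrict measurableSet_Iio, hset]
  by_cases hc : 0 < c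
  · constructor
    · have := intervalIntegral.intervalIntegrable_rpow' (a := 0) (b := c) (r := r - 1)
        (by linarith)
      rw [intervalIntegrable_iff_integrableOn_Ioc_of_le hc.le] at this
      exact this.mono_set Ioo_subset_Ioc_self
    · rw [← integral_Ioc_eq_integral_Ioo, ← intervalIntegral.integral_of_le hc.le,
        integral_rpow (Or.inl (by linarith)), sub_add_cancel, Real.zero_rpow hr.ne', sub_zero,
        truncPow, if_pos hc]
  · rw [Ioo_eq_empty hc, truncPow, if_neg hc]
    simp

theorem riemannLiouvilleMinus_indicator {r t : ℝ} (hr : 0 < r) (ht : 0 ≤ t) (x : ℝ) :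
    riemannLiouvilleMinus r (indicator (Ico (0 : ℝ) t) fun _ => 1) x =
      1 / Real.Gamma (r + 1) * mvnKernel r t x := by
  have e : ∀ s : ℝ, indicator (Ico (0 : ℝ) t) (fun _ => (1 : ℝ)) (x + s) * s ^ (r - 1) =
      (if s < t - x then s ^ (r - 1) else 0) - (if s < -x then s ^ (r - 1) else 0) := by
    intro s
    rw [indicator_Ico_eq_sub ht, sub_mul, ite_mul, ite_mul, one_mul, zero_mul]
    congr 2 <;> exact propext ⟨fun h => by linarith, fun h => by linarith⟩
  obtain ⟨i1, v1⟩ := integral_Ioi_rpow_of_lt_truncPow hr (t - x)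
  obtain ⟨i2, v2⟩ := integral_Ioi_rpow_of_lt_truncPow hr (-x)
  rw [riemannLiouvilleMinus]
  simp_rw [e]
  rw [integral_sub i1 i2, v1, v2, Real.Gamma_add_one hr.ne', mvnKernel]
  have := (Real.Gamma_pos_of_pos hr).ne'
  field_simp

theorem integral_Ioi_rpow_of_ge_truncPow {r ε : ℝ} (hr : 0 < r) {c : ℝ}
    (hc : 0 < c → ε < c) :
    IntegrableOn (fun s : ℝ => if 0 < c ∧ c ≤ s then s ^ (-(1 + r)) else 0) (Ioi ε) ∧
    ∫ s in Ioi ε, (if 0 < c ∧ c ≤ s then s ^ (-(1 + r)) else 0) = truncPow (-r) c / r := by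
  by_cases h : 0 < c
  · have e : (fun s : ℝ => if 0 < c ∧ c ≤ s then s ^ (-(1 + r)) else 0) =
        indicator (Ici c) fun s => s ^ (-(1 + r)) := by
      ext s; simp [indicator, h]
    have hset : Ici c ∩ Ioi ε = Ici c :=
      inter_eq_left.2 fun s hs => (hc h).trans_le hs
    rw [e, IntegrableOn, integrable_indicator_iff measurableSet_Ici, IntegrableOn,
      Measure.restrict_restrict measurableSet_Ici, integral_indicator measurableSet_Ici,
      Measure.restrict_restrict measurableSet_Ici, hset]
    constructor
    · exact (integrableOn_Ici_iff_integrableOn_Ioi).2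
        (integrableOn_Ioi_rpow_of_lt (by linarith) h)
    · rw [integral_Ici_eq_integral_Ioi, integral_Ioi_rpow_of_lt (by linarith) h, truncPow,
        if_pos h, show -(1 + r) + 1 = -r by ring, neg_div_neg_eq]
  · simp [h, truncPow]

/-- The integral over `(ε, ∞)` in the Marchaud derivative does not depend on `ε` once `ε` is smaller
than those of the numbers `t - x`, `-x` that are positive. -/
theorem marchaudMinus_indicator {r t : ℝ} (hr : 0 < r) (ht : 0 ≤ t) (x : ℝ) :
    marchaudMinus r (indicator (Ico (0 : ℝ) t) fun _ => 1) x =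
      1 / Real.Gamma (1 - r) * mvnKernel (-r) t x := by
  refine Tendsto.limUnder_eq (tendsto_const_nhds.congr' ?_)
  have hev : ∀ c : ℝ, ∀ᶠ ε in 𝓝[>] (0 : ℝ), 0 < c → ε < c := fun c => by
    by_cases hc : 0 < c
    · filter_upwards [Ioo_mem_nhdsGT hc] with ε hε _ using hε.2
    · exact Eventually.of_forall fun _ h => absurd h hc
  filter_upwards [hev (t - x), hev (-x), self_mem_nhdsWithin] with ε h1 h2 hε
  have hε0 : 0 < ε := hε
  obtain ⟨i1, v1⟩ := integral_Ioi_rpow_of_ge_truncPow hr h1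
  obtain ⟨i2, v2⟩ := integral_Ioi_rpow_of_ge_truncPow hr h2
  have e : ∀ s ∈ Ioi ε, (indicator (Ico (0 : ℝ) t) (fun _ => (1 : ℝ)) x -
      indicator (Ico (0 : ℝ) t) (fun _ => (1 : ℝ)) (x + s)) / s ^ (1 + r) =
      (if 0 < t - x ∧ t - x ≤ s then s ^ (-(1 + r)) else 0) -
        (if 0 < -x ∧ -x ≤ s then s ^ (-(1 + r)) else 0) := by
    intro s hs
    have hs0 : 0 < s := hε0.trans hs
    have hc : ∀ c : ℝ, (if x < c then (1 : ℝ) else 0) - (if x + s < c then 1 else 0) =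
        if 0 < c - x ∧ c - x ≤ s then 1 else 0 := by
      intro c
      by_cases a1 : x < c <;> by_cases a2 : x + s < c
      · rw [if_pos a1, if_pos a2, if_neg (by rintro ⟨-, h⟩; linarith), sub_self]
      · rw [if_pos a1, if_neg a2, if_pos ⟨by linarith, by linarith⟩, sub_zero]
      · linarith
      · rw [if_neg a1, if_neg a2, if_neg (by rintro ⟨h, -⟩; linarith), sub_self]
    have h0 := hc 0
    rw [zero_sub] at h0
    rw [indicator_Ico_eq_sub ht, indicator_Ico_eq_sub ht, sub_sub_sub_comm, hc, h0, sub_div,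
      ite_div, ite_div, Real.rpow_neg hs0.le, zero_div, one_div]
  rw [setIntegral_congr_fun measurableSet_Ioi e, integral_sub i1 i2, v1, v2, mvnKernel]
  field_simp

/-- The operator `M^{α/2}_-` maps `1_{[0,t)}` to a multiple of the Mandelbrot-van Ness kernel with
exponent `(α - 1) / 2`. -/
theorem fracOpMinus_indicator {α t : ℝ} (hα0 : 0 < α) (ht : 0 ≤ t) (x : ℝ) :
    fracOpMinus α (indicator (Ico (0 : ℝ) t) fun _ => 1) x =
      √(α * Real.sin (α * Real.pi / 2) * Real.Gamma α) / Real.Gamma ((α - 1) / 2 + 1) *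
        mvnKernel ((α - 1) / 2) t x := by
  rw [fracOpMinus]
  split_ifs with h1 h2
  · rw [marchaudMinus_indicator (by linarith) ht, show -((1 - α) / 2) = (α - 1) / 2 by ring,
      show 1 - (1 - α) / 2 = (α - 1) / 2 + 1 by ring]
    ring
  · -- for `α = 1` the exponent is `0`, and `y_+^0` is the indicator function of `y > 0`
    subst h2
    have : ∀ c : ℝ, truncPow 0 (c - x) = if x < c then 1 else 0 := fun c => by
      simp [truncPow]
    have h0 := this 0
    rw [zero_sub] at h0
    rw [indicator_Ico_eq_sub ht, sub_self, zero_div, mvnKernel, this, h0]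
    simp
  · rw [riemannLiouvilleMinus_indicator (lt_of_le_of_ne (by linarith) fun h => h2 (by linarith)) ht]
    ring

/-! ### Inner products of the kernels -/

section

variable {p : ℝ}

theorem measurable_truncPow : Measurable (truncPow p) :=
  Measurable.ite measurableSet_Ioi (by fun_prop) measurable_const

theorem measurable_mvnKernel (t : ℝ) : Measurable (mvnKernel p t) :=
  (measurable_truncPow.comp (measurable_const.sub measurable_id)).sub
    (measurable_truncPow.comp measurable_neg)

theorem truncPow_mul {t : ℝ} (ht : 0 < t) (y : ℝ) :
    truncPow p (t * y) = t ^ p * truncPow p y := by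
  by_cases hy : 0 < y
  · rw [truncPow, truncPow, if_pos hy, if_pos (mul_pos ht hy), Real.mul_rpow ht.le hy.le]
  · rw [truncPow, truncPow, if_neg hy, if_neg (fun h => hy (pos_of_mul_pos_right h ht.le)),
      mul_zero]

/-- The squared `L²`-norm of the Mandelbrot-van Ness kernel at time `1`, in closed form. -/
noncomputable def mvnConstant (p : ℝ) : ℝ :=
  Real.Gamma (p + 1) ^ 2 / (Real.Gamma (2 * p + 2) * Real.cos (Real.pi * p))

theorem integral_sq_mvnKernel_one (hp1 : -(1 / 2) < p) (hp2 : p < 1 / 2) :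
    Integrable (fun x => mvnKernel p 1 (-x) ^ 2) ∧
      ∫ x, mvnKernel p 1 (-x) ^ 2 = mvnConstant p := by
  have e1 : ∀ s ∈ Ioi (0 : ℝ), mvnKernel p 1 (-s) ^ 2 = ((1 + s) ^ p - s ^ p) ^ 2 := by
    intro s hs
    rw [mem_Ioi] at hs
    rw [mvnKernel, truncPow, truncPow, neg_neg, sub_neg_eq_add, if_pos hs, if_pos (by linarith)]
  have e2 : ∀ s ∈ Ioc (-1 : ℝ) 0, mvnKernel p 1 (-s) ^ 2 = (s + 1) ^ (2 * p) := by
    intro s hs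
    have h1 : 0 < 1 + s := by linarith [hs.1]
    rw [mvnKernel, truncPow, truncPow, neg_neg, sub_neg_eq_add, if_pos h1,
      if_neg (not_lt.2 hs.2), sub_zero, mul_comm 2 p, add_comm s, Real.rpow_mul h1.le,
      Real.rpow_two]
  have e3 : ∀ s ∈ Iic (-1 : ℝ), mvnKernel p 1 (-s) ^ 2 = 0 := by
    intro s hs
    rw [mem_Iic] at hs
    rw [mvnKernel, truncPow, truncPow, neg_neg, sub_neg_eq_add, if_neg (by linarith),
      if_neg (by linarith), sub_zero, zero_pow two_ne_zero]
  have i1 : IntegrableOn (fun s => mvnKernel p 1 (-s) ^ 2) (Ioi 0) :=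
    (integrableOn_sq_one_add_rpow_sub_rpow hp1 hp2).congr_fun
      (fun s hs => (e1 s hs).symm) measurableSet_Ioi
  have hii : IntervalIntegrable (fun s : ℝ => (s + 1) ^ (2 * p)) volume (-1) 0 := by
    have := (intervalIntegral.intervalIntegrable_rpow' (a := 0) (b := 1) (r := 2 * p)
      (by linarith)).comp_add_right 1
    simpa using this
  have i2 : IntegrableOn (fun s => mvnKernel p 1 (-s) ^ 2) (Ioc (-1) 0) :=
    ((intervalIntegrable_iff_integrableOn_Ioc_of_le (by norm_num)).1 hii).congr_fun
      (fun s hs => (e2 s hs).symm) measurableSet_Ioc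
  have i3 : IntegrableOn (fun s => mvnKernel p 1 (-s) ^ 2) (Iic (-1)) :=
    integrableOn_zero.congr_fun (fun s hs => (e3 s hs).symm) measurableSet_Iic
  have hu : Iic (-1 : ℝ) ∪ Ioc (-1) 0 = Iic 0 := Iic_union_Ioc_eq_Iic (by norm_num)
  have i4 : IntegrableOn (fun s => mvnKernel p 1 (-s) ^ 2) (Iic 0) := by
    rw [← hu]; exact i3.union i2
  have hint : Integrable (fun s => mvnKernel p 1 (-s) ^ 2) := by
    rw [← integrableOn_univ, ← Iic_union_Ioi (a := (0 : ℝ))]; exact i4.union i1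
  refine ⟨hint, ?_⟩
  have hI : ∫ s in Ioc (-1 : ℝ) 0, mvnKernel p 1 (-s) ^ 2 = 1 / (2 * p + 1) := by
    rw [setIntegral_congr_fun measurableSet_Ioc e2,
      ← intervalIntegral.integral_of_le (by norm_num),
      intervalIntegral.integral_comp_add_right (fun s : ℝ => s ^ (2 * p)), neg_add_cancel,
      zero_add, integral_rpow (Or.inl (by linarith)), Real.one_rpow,
      Real.zero_rpow (by linarith), sub_zero]
  rw [← setIntegral_univ, ← Iic_union_Ioi (a := (0 : ℝ)),
    setIntegral_union (Iic_disjoint_Ioi le_rfl) measurableSet_Ioi i4 i1, ← hu,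
    setIntegral_union (Iic_disjoint_Ioc le_rfl) measurableSet_Ioc i3 i2,
    setIntegral_congr_fun measurableSet_Iic e3, integral_zero, zero_add, hI,
    setIntegral_congr_fun measurableSet_Ioi e1, add_comm,
    mandelbrotVanNess_constant hp1 hp2, mvnConstant]

theorem integral_sq_mvnKernel (hp1 : -(1 / 2) < p) (hp2 : p < 1 / 2) {t : ℝ} (ht : 0 ≤ t) :
    Integrable (fun x => mvnKernel p t x ^ 2) ∧
      ∫ x, mvnKernel p t x ^ 2 = t ^ (2 * p + 1) * mvnConstant p := by
  rcases ht.eq_or_lt with rfl | ht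
  · have : ∀ x, mvnKernel p 0 x = 0 := fun x => by rw [mvnKernel, zero_sub, sub_self]
    simp [this, Real.zero_rpow (show 2 * p + 1 ≠ 0 by linarith)]
  -- the kernel at time `t` is `t^p` times the kernel at time `1`, evaluated at `x / t`
  have e : ∀ x, mvnKernel p t x ^ 2 = t ^ (2 * p) * mvnKernel p 1 (-(-t⁻¹ * x)) ^ 2 := by
    intro x
    have h1 : t - x = t * (1 - t⁻¹ * x) := by field_simp
    have h2 : -x = t * (-(t⁻¹ * x)) := by field_simp
    rw [mvnKernel, mvnKernel, h1, h2, truncPow_mul ht, truncPow_mul ht, mul_comm 2 p,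
      Real.rpow_mul ht.le, Real.rpow_two, neg_mul, neg_neg]
    ring
  obtain ⟨hi, hv⟩ := integral_sq_mvnKernel_one hp1 hp2
  simp_rw [e]
  refine ⟨(hi.comp_mul_left' (neg_ne_zero.2 (inv_ne_zero ht.ne'))).const_mul _, ?_⟩
  rw [integral_const_mul, Measure.integral_comp_mul_left (fun y => mvnKernel p 1 (-y) ^ 2), hv,
    inv_neg, inv_inv, abs_neg, abs_of_pos ht, smul_eq_mul, Real.rpow_add_one ht.ne']
  ring

theorem memLp_mvnKernel (hp1 : -(1 / 2) < p) (hp2 : p < 1 / 2) {t : ℝ} (ht : 0 ≤ t) :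
    MemLp (mvnKernel p t) 2 volume :=
  (memLp_two_iff_integrable_sq (measurable_mvnKernel t).aestronglyMeasurable).2
    (integral_sq_mvnKernel hp1 hp2 ht).1

/-- The increments of the kernel in `t` are translates of the kernel. -/
theorem integral_sq_mvnKernel_sub (hp1 : -(1 / 2) < p) (hp2 : p < 1 / 2) (s t : ℝ) :
    ∫ x, (mvnKernel p s x - mvnKernel p t x) ^ 2 = |s - t| ^ (2 * p + 1) * mvnConstant p := by
  wlog hst : t ≤ s generalizing s t
  · rw [abs_sub_comm, ← this t s (le_of_not_ge hst)]
    simp_rw [sub_sq_comm]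
  have e : ∀ x, mvnKernel p s x - mvnKernel p t x = mvnKernel p (s - t) (x - t) := by
    intro x
    rw [mvnKernel, mvnKernel, mvnKernel, sub_sub_sub_cancel_right, sub_sub_sub_cancel_right,
      neg_sub]
  simp_rw [e]
  rw [integral_sub_right_eq_self (fun x => mvnKernel p (s - t) x ^ 2),
    (integral_sq_mvnKernel hp1 hp2 (sub_nonneg.2 hst)).2, abs_of_nonneg (sub_nonneg.2 hst)]

/-- Polarization of the norms of the kernels and of their increments. -/
theorem integral_mvnKernel_mul (hp1 : -(1 / 2) < p) (hp2 : p < 1 / 2) {s t : ℝ} (hs : 0 ≤ s)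
    (ht : 0 ≤ t) :
    ∫ x, mvnKernel p s x * mvnKernel p t x =
      1 / 2 * (s ^ (2 * p + 1) + t ^ (2 * p + 1) - |s - t| ^ (2 * p + 1)) * mvnConstant p := by
  have hms := memLp_mvnKernel hp1 hp2 hs
  have hmt := memLp_mvnKernel hp1 hp2 ht
  obtain ⟨is, vs⟩ := integral_sq_mvnKernel hp1 hp2 hs
  obtain ⟨it, vt⟩ := integral_sq_mvnKernel hp1 hp2 ht
  have hd := integral_sq_mvnKernel_sub hp1 hp2 s t
  have id : Integrable fun x => (mvnKernel p s x - mvnKernel p t x) ^ 2 :=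
    (hms.sub hmt).integrable_sq
  have e : ∀ x, mvnKernel p s x * mvnKernel p t x = 1 / 2 *
      ((mvnKernel p s x ^ 2 + mvnKernel p t x ^ 2) - (mvnKernel p s x - mvnKernel p t x) ^ 2) :=
    fun x => by ring
  simp_rw [e]
  have ist : Integrable fun x => mvnKernel p s x ^ 2 + mvnKernel p t x ^ 2 := is.add it
  rw [integral_const_mul, integral_sub ist id, integral_add is it, vs, vt, hd]
  ring

end

/-- The constant in the definition of `M^{α/2}_-` normalises the kernel at time `1`. -/
theorem sq_mul_mvnConstant {α : ℝ} (hα0 : 0 < α) (hα2 : α < 2) :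
    (√(α * Real.sin (α * Real.pi / 2) * Real.Gamma α) / Real.Gamma ((α - 1) / 2 + 1)) ^ 2 *
      mvnConstant ((α - 1) / 2) = 1 := by
  have hpi := Real.pi_pos
  have hsin : 0 < Real.sin (α * Real.pi / 2) :=
    Real.sin_pos_of_pos_of_lt_pi (by positivity) (by nlinarith)
  have hG := Real.Gamma_pos_of_pos hα0
  have hG1 := Real.Gamma_pos_of_pos (show 0 < (α - 1) / 2 + 1 by linarith)
  rw [div_pow, Real.sq_sqrt (by positivity), mvnConstant,
    show 2 * ((α - 1) / 2) + 2 = α + 1 by ring, Real.Gamma_add_one hα0.ne',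
    show Real.pi * ((α - 1) / 2) = α * Real.pi / 2 - Real.pi / 2 by ring,
    Real.cos_sub_pi_div_two]
  generalize Real.Gamma ((α - 1) / 2 + 1) = g at *
  field_simp

theorem memLp_fracOpMinus_single {d : ℕ} {α : ℝ} (hα0 : 0 < α) (hα2 : α < 2) (k : Fin d)
    (t : ℝ≥0) :
    MemLp (fun x : ℝ => EuclideanSpace.single k
      (fracOpMinus α (indicator (Ico (0 : ℝ) t) fun _ => 1) x)) 2 volume := by
  have h1 := (memLp_mvnKernel (p := (α - 1) / 2) (by linarith) (by linarith)
    t.coe_nonneg).const_mul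
    (√(α * Real.sin (α * Real.pi / 2) * Real.Gamma α) / Real.Gamma ((α - 1) / 2 + 1))
  have h2 := (ContinuousLinearMap.toSpanSingleton ℝ
    (EuclideanSpace.single k (1 : ℝ) : EuclideanSpace ℝ (Fin d))).comp_memLp' h1
  refine MemLp.ae_eq (Eventually.of_forall fun x => ?_) h2
  beta_reduce
  rw [fracOpMinus_indicator hα0 t.coe_nonneg]
  simp only [Function.comp_apply, ContinuousLinearMap.toSpanSingleton_apply]
  ext i
  by_cases hi : i = k <;> simp [hi]

theorem inner_ggbmKernel {d : ℕ} {α : ℝ} (hα0 : 0 < α) (hα2 : α < 2) (i j : Fin d)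
    (s t : ℝ≥0) :
    inner ℝ (ggbmKernel d α i s) (ggbmKernel d α j t) =
      if i = j then 1 / 2 * ((s : ℝ) ^ α + (t : ℝ) ^ α - |(s : ℝ) - t| ^ α) else 0 := by
  have hs := memLp_fracOpMinus_single hα0 hα2 i s
  have ht := memLp_fracOpMinus_single hα0 hα2 j t
  set c := √(α * Real.sin (α * Real.pi / 2) * Real.Gamma α) / Real.Gamma ((α - 1) / 2 + 1) with hc
  have e : inner ℝ (ggbmKernel d α i s) (ggbmKernel d α j t) =
      ∫ x, (if i = j then c ^ 2 * (mvnKernel ((α - 1) / 2) s x * mvnKernel ((α - 1) / 2) t x)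
        else 0) := by
    rw [ggbmKernel, ggbmKernel, toL2, toL2, dif_pos hs, dif_pos ht, L2.inner_def]
    refine integral_congr_ae ?_
    filter_upwards [hs.coeFn_toLp, ht.coeFn_toLp] with x h1 h2
    rw [h1, h2, fracOpMinus_indicator hα0 s.coe_nonneg, fracOpMinus_indicator hα0 t.coe_nonneg,
      ← hc, EuclideanSpace.inner_single_left]
    by_cases hij : i = j
    · subst hij; simp; ring
    · simp [hij]
  rw [e]
  split_ifs with hij
  · rw [integral_const_mul, integral_mvnKernel_mul (by linarith) (by linarith) s.coe_nonneg
      t.coe_nonneg,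
      show 2 * ((α - 1) / 2) + 1 = α by ring]
    have := sq_mul_mvnConstant hα0 hα2
    rw [← hc] at this
    linear_combination (1 / 2 * ((s : ℝ) ^ α + (t : ℝ) ^ α - |(s : ℝ) - t| ^ α)) * this
  · exact integral_zero _ _

end MittagLeffler

theorem mainTheorem1 (β : ℝ) (hβ0 : 0 < β) (hβ1 : β ≤ 1) :
    (∀ (N : Type*) [AddCommGroup N] [Module ℝ N] [TopologicalSpace N]
        (H : Type*) [NormedAddCommGroup H] [InnerProductSpace ℝ H] [CompleteSpace H]
        [TopologicalSpace.SeparableSpace H] (T : MittagLeffler.NuclearTriple N H)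
        (μ : Measure (WeakDual ℝ N)), MittagLeffler.IsMittagLefflerMeasure β T.incl μ →
        ∀ (n : ℕ), 1 ≤ n → ∀ φ : Fin n → H, Orthonormal ℝ φ →
          (iIndepFun (fun (i : Fin n) (ω : WeakDual ℝ N) =>
              MittagLeffler.pairing T.incl μ (φ i) ω) μ ↔ n = 1 ∨ β = 1)) ∧
    (∀ (d : ℕ), 2 ≤ d → ∀ α : ℝ, 0 < α → α < 2 →
      ∀ μ : Measure (WeakDual ℝ (MittagLeffler.SchwartzD d)),
        MittagLeffler.IsMittagLefflerMeasure β (MittagLeffler.schwartzIncl d) μ →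
        List.TFAE [
          ∀ t : ℝ≥0, iIndepFun (fun k : Fin d => MittagLeffler.ggbm d α μ k t) μ,
          iIndepFun (fun (k : Fin d) (ω : WeakDual ℝ (MittagLeffler.SchwartzD d)) (t : ℝ≥0) =>
            MittagLeffler.ggbm d α μ k t ω) μ,
          MittagLeffler.IsFractionalBrownianMotion (α / 2) (MittagLeffler.ggbm d α μ) μ,
          β = 1]) := by
  refine ⟨fun N _ _ _ H _ _ _ _ T μ h n hn φ hφ =>
    h.iIndepFun_pairing_iff hβ0 hβ1 T.incl_denseRange hn hφ, fun d hd α hα0 hα2 μ h => ?_⟩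
  have hdense : DenseRange (MittagLeffler.schwartzIncl d) :=
    SchwartzMap.denseRange_toLpCLM (by norm_num)
  tfae_have 1 → 4 := fun hind => by
    -- the kernels of the components are orthonormal at time `1`
    have ho : Orthonormal ℝ fun k : Fin d => MittagLeffler.ggbmKernel d α k 1 := by
      rw [orthonormal_iff_ite]
      intro i j
      rw [MittagLeffler.inner_ggbmKernel hα0 hα2]
      norm_num [Real.zero_rpow hα0.ne']
    exact ((h.iIndepFun_pairing_iff hβ0 hβ1 hdense (by omega) ho).1 (hind 1)).resolve_left
      (by omega)
  tfae_have 4 → 3 := by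
    rintro rfl
    refine ⟨h.isGaussianProcess_pairing hdense fun q : Fin d × ℝ≥0 =>
      MittagLeffler.ggbmKernel d α q.1 q.2, fun i t => h.integral_pairing hdense _,
      fun i j s t => ?_⟩
    rw [mul_div_cancel₀ α two_ne_zero, ← MittagLeffler.inner_ggbmKernel hα0 hα2]
    exact h.covariance_pairing hdense _ _
  tfae_have 3 → 2 := fun hB => by
    have hG := hB.isGaussianProcess.comp_right fun q : (_ : Fin d) × ℝ≥0 => (q.1, q.2)
    exact IsGaussianProcess.iIndepFun_of_covariance_eq_zero
      (X := fun k t => MittagLeffler.ggbm d α μ k t) hG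
      (fun k t => (Lp.stronglyMeasurable _).measurable.aemeasurable)
      fun i j hij s t => by rw [hB.cov_eq, if_neg hij]
  tfae_have 2 → 1 := fun hind t => hind.comp (fun _ x => x t) fun _ => measurable_pi_apply t
  tfae_finish
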